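/- Setting. Let $n\ge 1$ battlefields have values $w_1,\dots,w_n>0$ with $\sum_b w_b=1$. For $P,R_A\ge 0$ and $R_B>0$ consider the following two-stage game. In Stage 1 player $A$ chooses $\boldsymbol p\in\Delta_n(P)=\{\boldsymbol p\in\mathbb R_+^n:\sum_b p_b=P\}$, which player $B$ observes. In Stage 2 the players $i\in\{A,B\}$ simultaneously choose probability distributions $F_i\in\mathcal L(R_i)$, i.e. distributions on $\mathbb R_+^n$ with $\mathbb E_{\boldsymbol x_i\sim F_i}[\sum_b x_{i,b}]\le R_i$. With $\boldsymbol x_A\sim F_A$ and $\boldsymbol x_B\sim F_B$ independent, player $A$ wins battlefield $b$ if $x_{A,b}+p_b>x_{B,b}$ and loses it if $x_{A,b}+p_b<x_{B,b}$; a tie is won by $A$ with probability $\tau_b$, where $\tau\in[0,1]^n$ is an arbitrary fixed tie-breaking rule. The payoff $U_A(\boldsymbol p,F_A,F_B)$ is the expected total value of the battlefields won by $A$, and $U_B=1-U_A$. A subgame-perfect equilibrium (SPE) consists of $\boldsymbol p^*\in\Delta_n(P)$ and, for every $\boldsymbol p\in\Delta_n(P)$, a Nash equilibrium $(F_A^*(\boldsymbol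 p),F_B^*(\boldsymbol p))$ of the Stage 2 game, such that $\boldsymbol p^*$ maximizes $\boldsymbol p\mapsto U_A(\boldsymbol p,F_A^*(\boldsymbol p),F_B^*(\boldsymbol p))$ over $\Delta_n(P)$. Write $\pi_A^*(P,R_A,R_B)$ for player $A$'s payoff in an SPE. Investment problem. Let player $A$ have a monetary budget $M_A>0$, with unit cost $c_A>0$ for pre-allocated resources and unit cost $1$ for real-time resources, and let $R_B>0$. Put $$\mathcal I(M_A)=\{(P,R_A)\in\mathbb R_+^2: R_A+c_AP\le M_A\},\qquad \pi_A^{\mathrm{opt}}=\max_{(P,R_A)\in\mathcal I(M_A)}\pi_A^*(P,R_A,R_B),$$ where the maximum is over those feasible $(P,R_A)$ for which an SPE exists. Theorem. For all $P,R_A\ge 0$, all SPEs give player $A$ the same payoff, so that $\pi_A^*(P,R_A,R_B)$ is unique whenever an SPE exists; an SPE exists whenever $R_A>0$, and also when $R_A=0$ if all ties are won by $B$ ($\tau=0$). Let $t:=\min\{1,M_A/R_B\}$. The maximum $\pi_A^{\mathrm{opt}}$ is attained, and $(P^*,R_A^*)$ is a maximizer if and only if $R_A^*=M_A-c_AP^*$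 and $$P^*\ \begin{cases}=\dfrac{2(1-c_A)}{2-c_A}\dfrac{M_A}{c_A}, & \text{if } c_A<t,\\[2mm] \in\Big[0,\dfrac{2(1-c_A)}{2-c_A}\dfrac{M_A}{c_A}\Big], & \text{if } c_A=t,\\[2mm] =0, & \text{if } c_A>t.\end{cases}$$ The optimal payoff is $$\pi_A^{\mathrm{opt}}=\begin{cases}1-\dfrac{R_B}{2M_A}c_A(2-c_A), & \text{if } c_A<t,\\[2mm] 1-\dfrac{R_B}{2M_A}, & \text{if } c_A\ge t\text{ and } M_A/R_B\ge 1,\\[2mm] \dfrac{M_A}{2R_B}, & \text{if } c_A\ge t\text{ and } M_A/R_B<1.\end{cases}$$ -/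

import Mathlib

open MeasureTheory
open scoped ENNReal NNReal

noncomputable section

namespace GeneralLotto

/-- The probability that player A wins a battlefield on which it has committed `a` resources in
total (pre-allocated plus real-time) and player B has committed `b`. A tie is won by player A with
probability `θ`. -/
def winProb (θ a b : ℝ) : ℝ :=
  if b < a then 1 else if a = b then θ else 0

/-- The set `Δ_n(P)` of pre-allocation profiles with total budget `P`. -/
def preallocations (n : ℕ) (P : ℝ) : Set (Fin n → ℝ) :=
  {p | (∀ b, 0 ≤ p b) ∧ ∑ b, p b = P}

/-- The set `L(R)` of real-time strategies: the laws of random allocations in `ℝ₊ⁿ` whose expected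
total expenditure does not exceed `R`. -/
def lottoStrategies (n : ℕ) (R : ℝ) : Set (Measure (Fin n → ℝ≥0)) :=
  {F | IsProbabilityMeasure F ∧ ∫⁻ x, ∑ b, (x b : ℝ≥0∞) ∂F ≤ ENNReal.ofReal R}

variable {n : ℕ}

/-- Expected payoff `U_A(p, F_A, F_B)` of player A; `w` are the battlefield values and `τ b` is the
probability that a tie on battlefield `b` is won by player A. The two players randomize
independently. -/
def payoffA (w τ p : Fin n → ℝ) (FA FB : Measure (Fin n → ℝ≥0)) : ℝ :=
  ∫ x, ∑ b, w b * winProb (τ b) ((x.1 b : ℝ) + p b) (x.2 b : ℝ) ∂(FA.prod FB)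

/-- Expected payoff `U_B = 1 - U_A` of player B (the total battlefield value is `1`). -/
def payoffB (w τ p : Fin n → ℝ) (FA FB : Measure (Fin n → ℝ≥0)) : ℝ :=
  1 - payoffA w τ p FA FB

/-- `(FA, FB)` is a Nash equilibrium of the simultaneous-move game that is played in the second
stage, given the pre-allocation profile `p`. -/
structure IsStageTwoNash (w τ p : Fin n → ℝ) (RA RB : ℝ)
    (FA FB : Measure (Fin n → ℝ≥0)) : Prop where
  memA : FA ∈ lottoStrategies n RA
  memB : FB ∈ lottoStrategies n RB
  bestA : ∀ GA ∈ lottoStrategies n RA, payoffA w τ p GA FB ≤ payoffA w τ p FA FB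
  bestB : ∀ GB ∈ lottoStrategies n RB, payoffB w τ p FA GB ≤ payoffB w τ p FA FB

/-- Subgame-perfect equilibrium of the two-stage game with budgets `P`, `RA`, `RB`: the second-stage
strategies `FA p`, `FB p` form a Nash equilibrium after every pre-allocation profile `p`, and
`pStar` is an optimal profile given these continuations. Only the values of `FA` and `FB` on
`preallocations n P` matter. -/
structure IsSPE (w τ : Fin n → ℝ) (P RA RB : ℝ) (pStar : Fin n → ℝ)
    (FA FB : (Fin n → ℝ) → Measure (Fin n → ℝ≥0)) : Prop where
  mem : pStar ∈ preallocations n P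
  nash : ∀ p ∈ preallocations n P, IsStageTwoNash w τ p RA RB (FA p) (FB p)
  optimal : ∀ p ∈ preallocations n P,
    payoffA w τ p (FA p) (FB p) ≤ payoffA w τ pStar (FA pStar) (FB pStar)

/-- `v` is the payoff `π_A^*(P, RA, RB)` of player A in some subgame-perfect equilibrium. -/
def IsSPEPayoff (w τ : Fin n → ℝ) (P RA RB v : ℝ) : Prop :=
  ∃ pStar FA FB, IsSPE w τ P RA RB pStar FA FB ∧ v = payoffA w τ pStar (FA pStar) (FB pStar)

/-- The set `I(M)` of investments `(P, RA) ∈ ℝ₊²` that player A can afford with monetary budget `M`,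
when pre-allocated resources cost `c` per unit and real-time resources cost `1` per unit. -/
def feasibleInvestments (M c : ℝ) : Set (ℝ × ℝ) :=
  {x | 0 ≤ x.1 ∧ 0 ≤ x.2 ∧ x.2 + c * x.1 ≤ M}

/-- `(P, RA)` maximizes player A's subgame-perfect equilibrium payoff among all feasible
investments, and the maximal payoff is `v`. -/
def IsOptimalInvestment (w τ : Fin n → ℝ) (M c RB P RA v : ℝ) : Prop :=
  (P, RA) ∈ feasibleInvestments M c ∧ IsSPEPayoff w τ P RA RB v ∧
    ∀ y ∈ feasibleInvestments M c, ∀ u, IsSPEPayoff w τ y.1 y.2 RB u → u ≤ v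

end GeneralLotto

end

/-!
In the second stage, player B can contest battlefield `b` with probability `μ b`, bidding uniformly
on an interval above the pre-allocation `p b`. Covering the pre-allocations leaves the budget
`D = RB - ∑ b, p b * μ b`, and with interval lengths proportional to `w b`, every reply of player A
earns at most `∑ b, w b * (1 - μ b) + RA * (∑ b, w b * μ b ^ 2) / (2 * D)`. At a minimiser `μ` of
this bound, the first-order conditions imply that player A secures the same amount by bidding
with probabilities `RA * μ b / D`. This is a saddle point, so the minimum is the value of the second
stage.

Constant profiles `μ b = m` give a bound on that value which depends on `p` only through the total
`P`, and by Jensen's inequality the pre-allocation proportional to `w` attains the least of these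
bounds. Hence the equilibrium payoff is the minimum over `m` of
`1 - m + RA * m ^ 2 / (2 * (RB - P * m))`.

If `c ≤ min 1 (M / RB)`, then `m = c * RB / M` gives the same payoff for every investment that
spends all of `M`, and this constant bounds all equilibrium payoffs. Along the budget line, the
excess of the `m`-bound over the constant has the sign of a quadratic in `m` with root `c * RB / M`,
so the constant is the equilibrium payoff if and only if that quadratic is nonnegative for all
admissible `m`. For a larger price, `(0, M)` is still affordable and was already optimal at the
price `min 1 (M / RB)`.
-/

namespace GeneralLotto

open Set Filter Topology

variable {n : ℕ} {w τ p : Fin n → ℝ} {P RA RB : ℝ}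

section WinProb

theorem winProb_of_gt (θ : ℝ) {a b : ℝ} (h : b < a) : winProb θ a b = 1 :=
  if_pos h

theorem winProb_of_lt (θ : ℝ) {a b : ℝ} (h : a < b) : winProb θ a b = 0 := by
  rw [winProb, if_neg h.not_gt, if_neg h.ne]

theorem winProb_mem_Icc {θ : ℝ} (hθ : θ ∈ Icc (0 : ℝ) 1) (a b : ℝ) :
    winProb θ a b ∈ Icc (0 : ℝ) 1 := by
  unfold winProb
  split_ifs
  exacts [right_mem_Icc.2 zero_le_one, hθ, left_mem_Icc.2 zero_le_one]

variable {α : Type*} [MeasurableSpace α] {f g : α → ℝ}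

theorem measurable_winProb (θ : ℝ) (hf : Measurable f) (hg : Measurable g) :
    Measurable fun x => winProb θ (f x) (g x) :=
  Measurable.ite (measurableSet_lt hg hf) measurable_const
    (Measurable.ite (measurableSet_eq_fun hf hg) measurable_const measurable_const)

theorem integrable_winProb (θ : ℝ) {μ : Measure α} [IsFiniteMeasure μ] (hf : Measurable f)
    (hg : Measurable g) : Integrable (fun x => winProb θ (f x) (g x)) μ := by
  refine .of_bound (measurable_winProb θ hf hg).aestronglyMeasurable (max 1 |θ|) (.of_forall ?_)
  intro x
  unfold winProb
  split_ifs <;> simp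

end WinProb

theorem measurable_toReal_apply (b : Fin n) : Measurable fun x : Fin n → ℝ≥0 => (x b : ℝ) :=
  (measurable_pi_apply b).coe_nnreal_real

theorem mem_lottoStrategies_iff {R : ℝ} (hR : 0 ≤ R) {F : Measure (Fin n → ℝ≥0)}
    [hF : IsProbabilityMeasure F] :
    F ∈ lottoStrategies n R ↔
      (∀ b, Integrable (fun x => (x b : ℝ)) F) ∧ ∑ b, ∫ x, (x b : ℝ) ∂F ≤ R := by
  have hcoe (b : Fin n) : Measurable fun x : Fin n → ℝ≥0 => (x b : ℝ≥0∞) :=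
    (measurable_pi_apply b).coe_nnreal_ennreal
  have hmem : F ∈ lottoStrategies n R ↔ ∑ b, ∫⁻ x, (x b : ℝ≥0∞) ∂F ≤ ENNReal.ofReal R := by
    rw [← lintegral_finsetSum _ fun b _ => hcoe b]
    exact and_iff_right hF
  have hsum (hi : ∀ b, Integrable (fun x => (x b : ℝ)) F) :
      ∑ b, ∫⁻ x, (x b : ℝ≥0∞) ∂F = ENNReal.ofReal (∑ b, ∫ x, (x b : ℝ) ∂F) := by
    rw [ENNReal.ofReal_sum_of_nonneg fun b _ => integral_nonneg fun x => (x b).coe_nonneg]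
    exact Finset.sum_congr rfl fun b _ => lintegral_coe_eq_integral _ (hi b)
  rw [hmem]
  constructor
  · intro h
    have hi (b : Fin n) : Integrable (fun x => (x b : ℝ)) F :=
      integrable_toReal_of_lintegral_ne_top (hcoe b).aemeasurable
        (((Finset.single_le_sum (fun _ _ => zero_le) (Finset.mem_univ b)).trans h).trans_lt
          ENNReal.ofReal_lt_top).ne
    exact ⟨hi, (ENNReal.ofReal_le_ofReal_iff hR).1 (hsum hi ▸ h)⟩
  · rintro ⟨hi, h⟩
    exact hsum hi ▸ ENNReal.ofReal_le_ofReal h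

section Payoff

variable {FA FB : Measure (Fin n → ℝ≥0)}

theorem integrable_winProb_prod [IsProbabilityMeasure FA] [IsProbabilityMeasure FB]
    (θ z : ℝ) (b : Fin n) :
    Integrable (fun x : (Fin n → ℝ≥0) × (Fin n → ℝ≥0) => winProb θ (x.1 b + z) (x.2 b))
      (FA.prod FB) :=
  integrable_winProb _ (((measurable_toReal_apply b).comp measurable_fst).add_const _)
    ((measurable_toReal_apply b).comp measurable_snd)

theorem payoffA_eq_sum [IsProbabilityMeasure FA] [IsProbabilityMeasure FB] :
    payoffA w τ p FA FB =
      ∑ b, w b * ∫ x, winProb (τ b) (x.1 b + p b) (x.2 b) ∂(FA.prod FB) := by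
  simp only [payoffA, ← integral_const_mul]
  exact integral_finsetSum _ fun b _ => (integrable_winProb_prod _ _ b).const_mul _

theorem sum_mul_integral_le (hw : ∀ b, 0 < w b) {R s : ℝ} (hR : 0 ≤ R) (hs : 0 ≤ s)
    {F : Measure (Fin n → ℝ≥0)} (hF : F ∈ lottoStrategies n R) {H : Fin n → (Fin n → ℝ≥0) → ℝ}
    (hH : ∀ b, Integrable (H b) F) {α : Fin n → ℝ} (h : ∀ b x, H b x ≤ α b + s * x b / w b) :
    ∑ b, w b * ∫ x, H b x ∂F ≤ ∑ b, w b * α b + s * R := by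
  have := hF.1
  obtain ⟨hi, hcost⟩ := (mem_lottoStrategies_iff hR).1 hF
  have hterm (b : Fin n) : w b * ∫ x, H b x ∂F ≤ w b * α b + s * ∫ x, (x b : ℝ) ∂F := by
    have hint : ∫ x, H b x ∂F ≤ ∫ x, (α b + s / w b * x b) ∂F :=
      integral_mono (hH b) ((integrable_const _).add ((hi b).const_mul _))
        fun x => (h b x).trans_eq (by rw [mul_div_right_comm])
    rw [integral_add (integrable_const _) ((hi b).const_mul _), integral_const_mul, integral_const,
      probReal_univ, one_smul] at hint
    calc w b * ∫ x, H b x ∂F ≤ w b * (α b + s / w b * ∫ x, (x b : ℝ) ∂F) :=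
          mul_le_mul_of_nonneg_left hint (hw b).le
      _ = w b * α b + s * ∫ x, (x b : ℝ) ∂F := by field_simp [(hw b).ne']
  calc ∑ b, w b * ∫ x, H b x ∂F ≤ ∑ b, (w b * α b + s * ∫ x, (x b : ℝ) ∂F) :=
        Finset.sum_le_sum fun b _ => hterm b
    _ = ∑ b, w b * α b + s * ∑ b, ∫ x, (x b : ℝ) ∂F := by
        rw [Finset.sum_add_distrib, Finset.mul_sum]
    _ ≤ ∑ b, w b * α b + s * R := by gcongr

theorem payoffA_le_of_integral_winProb_le (hw : ∀ b, 0 < w b) {s : ℝ} (hRA : 0 ≤ RA)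
    (hs : 0 ≤ s) (hA : FA ∈ lottoStrategies n RA) [IsProbabilityMeasure FB] {α : Fin n → ℝ}
    (h : ∀ b (x : ℝ≥0), ∫ y, winProb (τ b) (x + p b) (y b) ∂FB ≤ α b + s * x / w b) :
    payoffA w τ p FA FB ≤ ∑ b, w b * α b + s * RA := by
  have := hA.1
  calc payoffA w τ p FA FB
      = ∑ b, w b * ∫ x, ∫ y, winProb (τ b) (x b + p b) (y b) ∂FB ∂FA := by
        rw [payoffA_eq_sum]
        simp only [integral_prod _ (integrable_winProb_prod _ _ _)]
    _ ≤ ∑ b, w b * α b + s * RA :=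
        sum_mul_integral_le hw hRA hs hA
          (fun b => (integrable_winProb_prod _ _ b).integral_prod_left) fun b x => h b (x b)

theorem le_payoffA_of_le_integral_winProb (hw : ∀ b, 0 < w b) {s : ℝ} (hRB : 0 ≤ RB)
    (hs : 0 ≤ s) [IsProbabilityMeasure FA] (hB : FB ∈ lottoStrategies n RB) {α : Fin n → ℝ}
    (h : ∀ b (y : ℝ≥0), α b - s * y / w b ≤ ∫ x, winProb (τ b) (x b + p b) y ∂FA) :
    ∑ b, w b * α b - s * RB ≤ payoffA w τ p FA FB := by
  have := hB.1
  have hneg := sum_mul_integral_le hw hRB hs hB (α := fun b => -α b)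
    (H := fun b y => -∫ x, winProb (τ b) (x b + p b) (y b) ∂FA)
    (fun b => (integrable_winProb_prod _ _ b).integral_prod_right.neg)
    (fun b y => by linarith [h b (y b)])
  simp only [integral_neg, mul_neg, Finset.sum_neg_distrib] at hneg
  rw [payoffA_eq_sum]
  simp only [integral_prod_symm _ (integrable_winProb_prod _ _ _)]
  linarith

end Payoff

section Bid

/-- The amount bid on a battlefield as a function of a uniform random variable `v` on `[0, 1]`: it
is `0` with probability `1 - μ` and otherwise uniform on `[c, c + d * μ]`. -/
noncomputable def bid (c d μ : ℝ) (v : unitInterval) : ℝ≥0 :=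
  if (v : ℝ) ≤ μ then (c + d * (μ - v)).toNNReal else 0

/-- The strategy whose bid on battlefield `b` is contested with probability `μ b`, in the sense of
`bid`. The bids on all battlefields are driven by the same random variable, since only their
marginal laws affect payoffs and costs. -/
noncomputable def bidLaw (c d μ : Fin n → ℝ) : Measure (Fin n → ℝ≥0) :=
  (volume : Measure unitInterval).map fun v b => bid (c b) (d b) (μ b) v

variable {c d μ : ℝ}

theorem measurable_bid : Measurable (bid c d μ) :=
  Measurable.ite (measurableSet_le measurable_subtype_coe measurable_const)
    (by fun_prop) measurable_const

theorem measurable_toReal_bid : Measurable fun v => (bid c d μ v : ℝ) :=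
  measurable_bid.coe_nnreal_real

theorem le_bid {v : unitInterval} (hv : (v : ℝ) ≤ μ) : c + d * (μ - v) ≤ bid c d μ v := by
  rw [bid, if_pos hv]
  exact Real.le_coe_toNNReal _

theorem bid_le (hc : 0 ≤ c) (hd : 0 ≤ d) (hμ : 0 ≤ μ) (v : unitInterval) :
    (bid c d μ v : ℝ) ≤ c + d * μ := by
  have hv := v.2.1
  unfold bid
  split_ifs with h
  · rw [Real.coe_toNNReal _ (by nlinarith)]
    nlinarith
  · exact add_nonneg hc (mul_nonneg hd hμ)

theorem integral_bid (hc : 0 ≤ c) (hd : 0 ≤ d) (hμ : μ ∈ Icc (0 : ℝ) 1) :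
    ∫ v, (bid c d μ v : ℝ) = c * μ + d * (μ ^ 2 / 2) := by
  have hbid (v : unitInterval) :
      (bid c d μ v : ℝ) = indicator {x | x ≤ μ} (fun x => c + d * (μ - x)) (v : ℝ) := by
    unfold bid
    split_ifs with h
    · rw [indicator_of_mem (by exact h), Real.coe_toNNReal]
      nlinarith
    · rw [indicator_of_notMem (by exact h), NNReal.coe_zero]
  calc ∫ v, (bid c d μ v : ℝ)
      = ∫ x in Icc (0 : ℝ) 1, indicator {x | x ≤ μ} (fun x => c + d * (μ - x)) x := by
        simp only [hbid]
        exact integral_subtype measurableSet_Icc _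
    _ = ∫ x in (0 : ℝ)..1, indicator {x | x ≤ μ} (fun x => c + d * (μ - x)) x := by
        rw [integral_Icc_eq_integral_Ioc, intervalIntegral.integral_of_le zero_le_one]
    _ = ∫ x in (0 : ℝ)..μ, (c + d * (μ - x)) := intervalIntegral.integral_indicator hμ
    _ = c * μ + d * (μ ^ 2 / 2) := by
        have hi {g : ℝ → ℝ} (hg : Continuous g) := hg.intervalIntegrable (μ := volume) 0 μ
        rw [intervalIntegral.integral_add (hi (by fun_prop)) (hi (by fun_prop)),
          intervalIntegral.integral_const_mul,
          intervalIntegral.integral_sub (hi (by fun_prop)) (hi (by fun_prop)), integral_id]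
        simp only [intervalIntegral.integral_const, smul_eq_mul]
        ring

theorem integral_le_one_sub {f : unitInterval → ℝ} (hf : Integrable f) (hf1 : ∀ v, f v ≤ 1)
    {r : ℝ} (hr : r ≤ 1) (hf0 : ∀ v : unitInterval, (v : ℝ) < r → f v ≤ 0) :
    ∫ v, f v ≤ 1 - r := by
  rcases lt_or_ge r 0 with hr0 | hr0
  · calc ∫ v, f v ≤ ∫ _ : unitInterval, (1 : ℝ) := integral_mono hf (integrable_const _) hf1
      _ ≤ 1 - r := by simp [hr0.le]
  · let a : unitInterval := ⟨r, hr0, hr⟩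
    calc ∫ v, f v ≤ ∫ v, (Ici a).indicator 1 v := by
          refine integral_mono hf ((integrable_const 1).indicator measurableSet_Ici) fun v => ?_
          by_cases hv : v ∈ Ici a
          · exact (hf1 v).trans_eq (indicator_of_mem hv (1 : unitInterval → ℝ)).symm
          · exact (hf0 v (not_le.1 hv)).trans_eq (indicator_of_notMem hv _).symm
      _ = 1 - r := by
          rw [integral_indicator_one measurableSet_Ici, Measure.real, unitInterval.volume_Ici,
            ENNReal.toReal_ofReal (sub_nonneg.2 hr)]

theorem integral_winProb_bid_le {θ : ℝ} (hθ : θ ∈ Icc (0 : ℝ) 1) (hd : 0 < d) (hμ : μ ≤ 1) {x : ℝ}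
    (hx : 0 ≤ x) : ∫ v, winProb θ (x + c) (bid c d μ v) ≤ 1 - μ + x / d := by
  have hxd : 0 ≤ x / d := by positivity
  suffices ∫ v, winProb θ (x + c) (bid c d μ v) ≤ 1 - (μ - x / d) by linarith
  refine integral_le_one_sub (integrable_winProb _ measurable_const measurable_toReal_bid)
    (fun v => (winProb_mem_Icc hθ _ _).2) (by linarith) fun v hv => (winProb_of_lt _ ?_).le
  have hlt : x < d * (μ - v) := by
    rw [← div_lt_iff₀' hd]
    linarith
  linarith [le_bid (c := c) (d := d) (by linarith : (v : ℝ) ≤ μ)]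

theorem le_integral_winProb_bid {θ : ℝ} (hθ : θ ∈ Icc (0 : ℝ) 1) (hd : 0 < d) {q e : ℝ}
    (he : 0 ≤ e) (hμe : 1 - μ - q / d ≤ e) {y : ℝ} (hy : 0 ≤ y) :
    1 - e - y / d ≤ ∫ v, winProb θ (bid 0 d μ v + q) y := by
  have hyd : 0 ≤ y / d := by positivity
  have hint := integrable_winProb θ (μ := (volume : Measure unitInterval))
    ((measurable_toReal_bid (c := 0) (d := d) (μ := μ)).add_const q) (measurable_const (a := y))
  suffices ∫ v, (1 - winProb θ (bid 0 d μ v + q) y) ≤ 1 - (1 - e - y / d) by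
    rw [integral_sub (integrable_const _) hint, integral_const, probReal_univ, one_smul] at this
    linarith
  refine integral_le_one_sub ((integrable_const _).sub hint)
    (fun v => sub_le_self _ (winProb_mem_Icc hθ _ _).1) (by linarith) fun v hv =>
    (sub_eq_zero.2 (winProb_of_gt _ ?_).symm).le
  have hbid : d * (μ - v) ≤ bid 0 d μ v := by
    rcases le_or_gt (v : ℝ) μ with h | h
    · simpa using le_bid (c := 0) (d := d) h
    · exact (mul_nonpos_of_nonneg_of_nonpos hd.le (by linarith)).trans NNReal.zero_le_coe
  have hlt : (y - q) / d < μ - v := by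
    rw [sub_div]
    linarith
  rw [div_lt_iff₀' hd] at hlt
  linarith

end Bid

section BidLaw

variable {c d μ : Fin n → ℝ}

theorem measurable_bids : Measurable fun v b => bid (c b) (d b) (μ b) v :=
  measurable_pi_lambda _ fun _ => measurable_bid

instance isProbabilityMeasure_bidLaw : IsProbabilityMeasure (bidLaw c d μ) :=
  Measure.isProbabilityMeasure_map measurable_bids.aemeasurable

theorem integral_bidLaw {h : ℝ → ℝ} (hh : Measurable h) (b : Fin n) :
    ∫ x, h (x b) ∂bidLaw c d μ = ∫ v, h (bid (c b) (d b) (μ b) v) :=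
  integral_map measurable_bids.aemeasurable
    (hh.comp (measurable_toReal_apply b)).aestronglyMeasurable

theorem bidLaw_mem_lottoStrategies (hc : ∀ b, 0 ≤ c b) (hd : ∀ b, 0 ≤ d b)
    (hμ : ∀ b, μ b ∈ Icc (0 : ℝ) 1) {R : ℝ} (hR : 0 ≤ R)
    (hcost : ∑ b, (c b * μ b + d b * (μ b ^ 2 / 2)) ≤ R) :
    bidLaw c d μ ∈ lottoStrategies n R := by
  refine (mem_lottoStrategies_iff hR).2 ⟨fun b => ?_, ?_⟩
  · refine (integrable_map_measure (measurable_toReal_apply b).aestronglyMeasurable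
      measurable_bids.aemeasurable).2 (.of_bound measurable_toReal_bid.aestronglyMeasurable
      (c b + d b * μ b) (.of_forall fun v => ?_))
    exact (Real.norm_of_nonneg NNReal.zero_le_coe).trans_le (bid_le (hc b) (hd b) (hμ b).1 v)
  · convert hcost with b
    exact (integral_bidLaw measurable_id b).trans (integral_bid (hc b) (hd b) (hμ b))

end BidLaw

section Contest

/-- What player B has left of its budget `RB` if it covers the pre-allocation `p b` on each
battlefield `b` with probability `μ b`. -/
def residualBudget (p : Fin n → ℝ) (RB : ℝ) (μ : Fin n → ℝ) : ℝ :=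
  RB - ∑ b, p b * μ b

/-- The profiles of probabilities with which player B can contest the battlefields, that is, bid
strictly more than the pre-allocations with budget `RB`. -/
def contestProfiles (p : Fin n → ℝ) (RB : ℝ) : Set (Fin n → ℝ) :=
  {μ | μ ∈ Icc 0 1 ∧ 0 < residualBudget p RB μ}

/-- The marginal value to player A of its real-time budget if player B uses the contest profile
`μ` and spreads its residual budget optimally. -/
noncomputable def priceA (w p : Fin n → ℝ) (RB : ℝ) (μ : Fin n → ℝ) : ℝ :=
  (∑ b, w b * μ b ^ 2) / (2 * residualBudget p RB μ)

/-- The payoff that player B allows player A by using the contest profile `μ`. -/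
noncomputable def contestPayoff (w p : Fin n → ℝ) (RA RB : ℝ) (μ : Fin n → ℝ) : ℝ :=
  ∑ b, w b * (1 - μ b) + priceA w p RB μ * RA

variable {μ : Fin n → ℝ}

theorem continuous_residualBudget : Continuous (residualBudget p RB) := by
  unfold residualBudget
  fun_prop

theorem budget_pos_of_mem_contestProfiles (hp : ∀ b, 0 ≤ p b) (hμ : μ ∈ contestProfiles p RB) :
    0 < RB :=
  (sub_pos.1 hμ.2).trans_le' (Finset.sum_nonneg fun b _ => mul_nonneg (hp b) (hμ.1.1 b))

theorem sum_mul_sq_nonneg (hw : ∀ b, 0 < w b) : 0 ≤ ∑ b, w b * μ b ^ 2 :=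
  Finset.sum_nonneg fun b _ => mul_nonneg (hw b).le (sq_nonneg _)

theorem sum_mul_sq_eq_zero_iff (hw : ∀ b, 0 < w b) : ∑ b, w b * μ b ^ 2 = 0 ↔ μ = 0 := by
  rw [Finset.sum_eq_zero_iff_of_nonneg fun b _ => mul_nonneg (hw b).le (sq_nonneg _), funext_iff]
  simp [(hw _).ne']

theorem priceA_nonneg (hw : ∀ b, 0 < w b) (hμ : μ ∈ contestProfiles p RB) :
    0 ≤ priceA w p RB μ :=
  div_nonneg (sum_mul_sq_nonneg hw) (mul_pos two_pos hμ.2).le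

theorem bidLaw_div_mem_lottoStrategies {c : Fin n → ℝ} (hw : ∀ b, 0 < w b) (hc : ∀ b, 0 ≤ c b)
    (hμ : μ ∈ Icc 0 1) {s R : ℝ} (hs : 0 < s) (hR : 0 ≤ R)
    (hcost : ∑ b, c b * μ b + (∑ b, w b * μ b ^ 2) / (2 * s) ≤ R) :
    bidLaw c (fun b => w b / s) μ ∈ lottoStrategies n R := by
  refine bidLaw_mem_lottoStrategies hc (fun b => div_nonneg (hw b).le hs.le)
    (fun b => ⟨hμ.1 b, hμ.2 b⟩) hR (le_of_eq_of_le ?_ hcost)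
  rw [Finset.sum_add_distrib, Finset.sum_div]
  congr! 2
  field_simp

theorem payoffA_bidLaw_le (hw : ∀ b, 0 < w b) (hτ : ∀ b, τ b ∈ Icc (0 : ℝ) 1) (hRA : 0 ≤ RA)
    {s : ℝ} (hs : 0 < s) (hμ : ∀ b, μ b ≤ 1) {FA : Measure (Fin n → ℝ≥0)}
    (hA : FA ∈ lottoStrategies n RA) :
    payoffA w τ p FA (bidLaw p (fun b => w b / s) μ) ≤ ∑ b, w b * (1 - μ b) + s * RA := by
  refine payoffA_le_of_integral_winProb_le hw hRA hs.le hA fun b x => ?_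
  rw [integral_bidLaw (h := winProb (τ b) (x + p b))
    (measurable_winProb _ measurable_const measurable_id)]
  refine (integral_winProb_bid_le (hτ b) (div_pos (hw b) hs) (hμ b) x.coe_nonneg).trans_eq ?_
  rw [div_div_eq_mul_div, mul_comm s]

theorem le_payoffA_bidLaw (hw : ∀ b, 0 < w b) (hτ : ∀ b, τ b ∈ Icc (0 : ℝ) 1) (hRB : 0 ≤ RB)
    {r : ℝ} (hr : 0 < r) {e : Fin n → ℝ} (he : ∀ b, 0 ≤ e b)
    (hμe : ∀ b, 1 - μ b - r * p b / w b ≤ e b) {FB : Measure (Fin n → ℝ≥0)}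
    (hB : FB ∈ lottoStrategies n RB) :
    ∑ b, w b * (1 - e b) - r * RB ≤ payoffA w τ p (bidLaw 0 (fun b => w b / r) μ) FB := by
  refine le_payoffA_of_le_integral_winProb hw hRB hr.le hB fun b y => ?_
  rw [integral_bidLaw (h := fun x => winProb (τ b) (x + p b) y)
    (measurable_winProb _ (by fun_prop) measurable_const), mul_comm r, ← div_div_eq_mul_div]
  refine le_integral_winProb_bid (hτ b) (div_pos (hw b) hr) (he b) ?_ y.coe_nonneg
  rw [div_div_eq_mul_div, mul_comm (p b)]
  exact hμe b

theorem IsStageTwoNash.payoffA_le_contestPayoff (hw : ∀ b, 0 < w b)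
    (hτ : ∀ b, τ b ∈ Icc (0 : ℝ) 1) (hp : ∀ b, 0 ≤ p b) (hRA : 0 ≤ RA)
    {FA FB : Measure (Fin n → ℝ≥0)} (hF : IsStageTwoNash w τ p RA RB FA FB)
    (hμ : μ ∈ contestProfiles p RB) :
    payoffA w τ p FA FB ≤ contestPayoff w p RA RB μ := by
  have hbound : ∀ s > priceA w p RB μ,
      payoffA w τ p FA FB ≤ ∑ b, w b * (1 - μ b) + s * RA := fun s hs => by
    have hs0 : 0 < s := (priceA_nonneg hw hμ).trans_lt hs
    have hmem : bidLaw p (fun b => w b / s) μ ∈ lottoStrategies n RB := by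
      refine bidLaw_div_mem_lottoStrategies hw hp hμ.1 hs0
        (budget_pos_of_mem_contestProfiles hp hμ).le ?_
      rw [gt_iff_lt, priceA, div_lt_iff₀ (mul_pos two_pos hμ.2)] at hs
      rw [← le_sub_iff_add_le', div_le_iff₀ (by positivity)]
      exact hs.le.trans_eq (by rw [residualBudget]; ring)
    exact (sub_le_sub_iff_left 1).1 (hF.bestB _ hmem) |>.trans
      (payoffA_bidLaw_le hw hτ hRA hs0 hμ.1.2 hF.memA)
  have hlim : Tendsto (fun s => ∑ b, w b * (1 - μ b) + s * RA) (𝓝[>] priceA w p RB μ)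
      (𝓝 (contestPayoff w p RA RB μ)) :=
    (Continuous.tendsto (by fun_prop) _).mono_left nhdsWithin_le_nhds
  exact ge_of_tendsto hlim (eventually_mem_nhdsWithin.mono hbound)

theorem exists_isMinOn_contestPayoff (hw : ∀ b, 0 < w b) (hRA : 0 < RA) (hRB : 0 < RB) :
    ∃ μ ∈ contestProfiles p RB, IsMinOn (contestPayoff w p RA RB) (contestProfiles p RB) μ := by
  -- `contestProfiles` is not closed. With the price as a second variable, the constraint
  -- `∑ b, w b * μ b ^ 2 ≤ 2 * s * residualBudget p RB μ` is closed and still keeps the residual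
  -- budget positive.
  let payoff : (Fin n → ℝ) × ℝ → ℝ := fun z => ∑ b, w b * (1 - z.1 b) + z.2 * RA
  let K : Set ((Fin n → ℝ) × ℝ) := Icc 0 1 ×ˢ Icc 0 ((∑ b, w b) / RA) ∩
    {z | 0 ≤ residualBudget p RB z.1 ∧
      ∑ b, w b * z.1 b ^ 2 ≤ z.2 * (2 * residualBudget p RB z.1)}
  have hT : 0 ≤ ∑ b, w b := Finset.sum_nonneg fun b _ => (hw b).le
  have hD : Continuous (residualBudget p RB) := continuous_residualBudget
  have hK : IsCompact K := (isCompact_Icc.prod isCompact_Icc).inter_right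
    ((isClosed_le (by fun_prop) (by fun_prop)).and (isClosed_le (by fun_prop) (by fun_prop)))
  have hzero : (0, 0) ∈ K :=
    ⟨⟨⟨le_rfl, zero_le_one⟩, le_rfl, div_nonneg hT hRA.le⟩, by simp [residualBudget, hRB.le]⟩
  obtain ⟨⟨μ, s⟩, ⟨⟨hμ, -⟩, hD0, hS⟩, hmin⟩ :=
    hK.exists_isMinOn ⟨_, hzero⟩ (by fun_prop : Continuous payoff).continuousOn
  have hDpos : 0 < residualBudget p RB μ := by
    refine hD0.lt_of_ne fun hD0' => hRB.ne ?_
    have hμ0 : μ = 0 := (sum_mul_sq_eq_zero_iff hw).1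
      ((hS.trans_eq (by simp [← hD0'])).antisymm (sum_mul_sq_nonneg hw))
    simpa [hμ0, residualBudget] using hD0'
  have hle : contestPayoff w p RA RB μ ≤ payoff (μ, s) := by
    have hs : priceA w p RB μ ≤ s := (div_le_iff₀ (by positivity)).2 hS
    exact (add_le_add_iff_left _).2 (mul_le_mul_of_nonneg_right hs hRA.le)
  refine ⟨μ, ⟨hμ, hDpos⟩, fun g hg => hle.trans ?_⟩
  rcases le_total (priceA w p RB g) ((∑ b, w b) / RA) with h | h
  · exact hmin (a := (g, priceA w p RB g)) ⟨⟨hg.1, priceA_nonneg hw hg, h⟩, hg.2.le,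
      (div_mul_cancel₀ _ (mul_pos two_pos hg.2).ne').ge⟩
  · calc payoff (μ, s) ≤ payoff (0, 0) := hmin hzero
      _ = 0 + ∑ b, w b := by simp [payoff]
      _ ≤ contestPayoff w p RA RB g :=
        add_le_add (Finset.sum_nonneg fun b _ => mul_nonneg (hw b).le (sub_nonneg.2 (hg.1.2 b)))
          ((div_le_iff₀ hRA).1 h)

end Contest

theorem nonneg_of_eventually_nonneg_mul {a b : ℝ} (h : ∀ᶠ x in 𝓝[>] 0, 0 ≤ x * (a * x + b)) :
    0 ≤ b := by
  have hlim : Tendsto (fun x => a * x + b) (𝓝[>] 0) (𝓝 b) :=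
    (Continuous.tendsto' (by fun_prop) 0 b (by simp)).mono_left nhdsWithin_le_nhds
  refine ge_of_tendsto hlim ?_
  filter_upwards [h, self_mem_nhdsWithin] with x hx hx0
  exact (mul_nonneg_iff_of_pos_left hx0).1 hx

section Saddle

/-- The probabilities with which player A bids a positive amount in its reply to the contest
profile `μ`. -/
noncomputable def counterContest (p : Fin n → ℝ) (RA RB : ℝ) (μ : Fin n → ℝ) (b : Fin n) : ℝ :=
  RA * μ b / residualBudget p RB μ

/-- The marginal value to player B of its budget at the contest profile `μ`. -/
noncomputable def priceB (w p : Fin n → ℝ) (RA RB : ℝ) (μ : Fin n → ℝ) : ℝ :=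
  priceA w p RB μ * RA / residualBudget p RB μ

/-- The marginal gain of player B from contesting battlefield `b` more often, that is, minus the
partial derivative of `contestPayoff` at `μ` in direction `b`. -/
noncomputable def contestGain (w p : Fin n → ℝ) (RA RB : ℝ) (μ : Fin n → ℝ) (b : Fin n) : ℝ :=
  w b * (1 - counterContest p RA RB μ b) - priceB w p RA RB μ * p b

variable {μ g : Fin n → ℝ}

theorem residualBudget_add_smul (h : Fin n → ℝ) (ε : ℝ) :
    residualBudget p RB (μ + ε • h) = residualBudget p RB μ - ε * ∑ b, p b * h b := by
  simp only [residualBudget, Pi.add_apply, Pi.smul_apply, smul_eq_mul, mul_add,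
    Finset.sum_add_distrib, Finset.mul_sum, mul_left_comm]
  ring

theorem sum_mul_sq_add_smul (h : Fin n → ℝ) (ε : ℝ) :
    ∑ b, w b * (μ + ε • h) b ^ 2 =
      ∑ b, w b * μ b ^ 2 + ε * (2 * ∑ b, w b * μ b * h b) + ε ^ 2 * ∑ b, w b * h b ^ 2 := by
  simp only [Finset.mul_sum, ← Finset.sum_add_distrib, Pi.add_apply, Pi.smul_apply, smul_eq_mul]
  exact Finset.sum_congr rfl fun b _ => by ring

theorem sum_mul_one_sub_add_smul (h : Fin n → ℝ) (ε : ℝ) :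
    ∑ b, w b * (1 - (μ + ε • h) b) = ∑ b, w b * (1 - μ b) - ε * ∑ b, w b * h b := by
  simp only [Finset.mul_sum, ← Finset.sum_sub_distrib, Pi.add_apply, Pi.smul_apply, smul_eq_mul]
  exact Finset.sum_congr rfl fun b _ => by ring

theorem sum_mul_contestGain (h : Fin n → ℝ) :
    ∑ b, h b * contestGain w p RA RB μ b = ∑ b, w b * h b -
      (RA / residualBudget p RB μ * ∑ b, w b * μ b * h b +
        priceB w p RA RB μ * ∑ b, p b * h b) := by
  simp only [Finset.mul_sum, ← Finset.sum_add_distrib, ← Finset.sum_sub_distrib, contestGain,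
    counterContest]
  exact Finset.sum_congr rfl fun b _ => by ring

theorem eventually_add_smul_mem_contestProfiles (hμ : μ ∈ contestProfiles p RB)
    (hg : g ∈ Icc 0 1) : ∀ᶠ ε in 𝓝[>] (0 : ℝ), μ + ε • (g - μ) ∈ contestProfiles p RB := by
  have hD : Tendsto (fun ε : ℝ => residualBudget p RB (μ + ε • (g - μ))) (𝓝[>] 0)
      (𝓝 (residualBudget p RB μ)) := by
    simp only [residualBudget_add_smul]
    exact (Continuous.tendsto' (by fun_prop) _ _ (by simp)).mono_left nhdsWithin_le_nhds
  filter_upwards [hD.eventually_const_lt hμ.2, Ioc_mem_nhdsGT zero_lt_one] with ε hε hε1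
  exact ⟨(convex_Icc (0 : Fin n → ℝ) 1).add_smul_sub_mem hμ.1 hg (Ioc_subset_Icc_self hε1), hε⟩

theorem contestPayoff_add_smul_sub (h : Fin n → ℝ) (hμ : 0 < residualBudget p RB μ) {ε : ℝ}
    (hε : 0 < residualBudget p RB (μ + ε • h)) :
    (contestPayoff w p RA RB (μ + ε • h) - contestPayoff w p RA RB μ) *
        (2 * residualBudget p RB μ * residualBudget p RB (μ + ε • h)) =
      ε * ((2 * residualBudget p RB μ * (∑ b, w b * h b) * (∑ b, p b * h b) +
          RA * (∑ b, w b * h b ^ 2) * residualBudget p RB μ) * ε +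
        2 * residualBudget p RB μ ^ 2 * -∑ b, h b * contestGain w p RA RB μ b) := by
  rw [residualBudget_add_smul] at hε ⊢
  rw [sum_mul_contestGain, contestPayoff, contestPayoff, priceB, priceA, priceA,
    sum_mul_one_sub_add_smul, sum_mul_sq_add_smul, residualBudget_add_smul]
  field_simp
  ring

theorem sum_mul_contestGain_le (hμ : μ ∈ contestProfiles p RB)
    (hmin : IsMinOn (contestPayoff w p RA RB) (contestProfiles p RB) μ) (hg : g ∈ Icc 0 1) :
    ∑ b, g b * contestGain w p RA RB μ b ≤ ∑ b, μ b * contestGain w p RA RB μ b := by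
  have hD : 0 < residualBudget p RB μ := hμ.2
  have hderiv : 0 ≤ 2 * residualBudget p RB μ ^ 2 *
      -∑ b, (g - μ) b * contestGain w p RA RB μ b := by
    refine nonneg_of_eventually_nonneg_mul
      (a := 2 * residualBudget p RB μ * (∑ b, w b * (g - μ) b) * (∑ b, p b * (g - μ) b) +
        RA * (∑ b, w b * (g - μ) b ^ 2) * residualBudget p RB μ) ?_
    filter_upwards [eventually_add_smul_mem_contestProfiles hμ hg] with ε hε
    rw [← contestPayoff_add_smul_sub _ hD hε.2]
    exact mul_nonneg (sub_nonneg.2 (hmin hε)) (mul_pos (by positivity) hε.2).le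
  have hsum := neg_nonneg.1 ((mul_nonneg_iff_of_pos_left (by positivity)).1 hderiv)
  simpa only [Pi.sub_apply, sub_mul, Finset.sum_sub_distrib, sub_nonpos] using hsum

theorem sum_mul_sq_pos_of_isMinOn (hw : ∀ b, 0 < w b) (hw0 : 0 < ∑ b, w b)
    (hμ : μ ∈ contestProfiles p RB)
    (hmin : IsMinOn (contestPayoff w p RA RB) (contestProfiles p RB) μ) :
    0 < ∑ b, w b * μ b ^ 2 := by
  refine (sum_mul_sq_nonneg hw).lt_of_ne fun h => hw0.not_ge ?_
  have hμ0 : μ = 0 := (sum_mul_sq_eq_zero_iff hw).1 h.symm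
  have hone := sum_mul_contestGain_le hμ hmin (right_mem_Icc.2 zero_le_one)
  simpa [hμ0, contestGain, counterContest, priceB, priceA] using hone

theorem counterContest_mem_Icc_of_isMinOn (hw : ∀ b, 0 < w b) (hp : ∀ b, 0 ≤ p b) (hRA : 0 ≤ RA)
    (hμ : μ ∈ contestProfiles p RB)
    (hmin : IsMinOn (contestPayoff w p RA RB) (contestProfiles p RB) μ) :
    counterContest p RA RB μ ∈ Icc 0 1 := by
  refine ⟨fun b => div_nonneg (mul_nonneg hRA (hμ.1.1 b)) hμ.2.le, fun b => ?_⟩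
  rcases (hμ.1.1 b).eq_or_lt' with hμb | hμb
  · simp_all [counterContest]
  have hgain : 0 ≤ μ b * contestGain w p RA RB μ b := by
    have hdrop : Function.update μ b 0 ∈ Icc (0 : Fin n → ℝ) 1 :=
      ⟨le_update_iff.2 ⟨le_rfl, fun c _ => hμ.1.1 c⟩,
        update_le_iff.2 ⟨zero_le_one, fun c _ => hμ.1.2 c⟩⟩
    have := sum_mul_contestGain_le hμ hmin hdrop
    rw [← Finset.add_sum_erase _ _ (Finset.mem_univ b),
      ← Finset.add_sum_erase Finset.univ (fun c => μ c * _) (Finset.mem_univ b),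
      Finset.sum_congr rfl fun c hc => by rw [Function.update_of_ne (Finset.ne_of_mem_erase hc)]]
      at this
    simpa using this
  have hprice : 0 ≤ priceB w p RA RB μ * p b :=
    mul_nonneg (div_nonneg (mul_nonneg (priceA_nonneg hw hμ) hRA) hμ.2.le) (hp b)
  have hle : 0 ≤ w b * (1 - counterContest p RA RB μ b) :=
    ((mul_nonneg_iff_of_pos_left hμb).1 hgain).trans (sub_le_self _ hprice)
  exact sub_nonneg.1 ((mul_nonneg_iff_of_pos_left (hw b)).1 hle)

theorem sum_max_contestGain_le (hμ : μ ∈ contestProfiles p RB)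
    (hmin : IsMinOn (contestPayoff w p RA RB) (contestProfiles p RB) μ) :
    ∑ b, max 0 (contestGain w p RA RB μ b) ≤ ∑ b, μ b * contestGain w p RA RB μ b := by
  let g : Fin n → ℝ := fun b => if 0 ≤ contestGain w p RA RB μ b then 1 else 0
  have hg : g ∈ Icc 0 1 := ⟨fun b => by simp only [g]; split_ifs <;> simp,
    fun b => by simp only [g]; split_ifs <;> simp⟩
  refine le_of_eq_of_le (Finset.sum_congr rfl fun b _ => ?_) (sum_mul_contestGain_le hμ hmin hg)
  simp only [g, ite_mul, one_mul, zero_mul]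
  exact max_def _ _

theorem contestPayoff_eq (hμ : μ ∈ contestProfiles p RB) :
    contestPayoff w p RA RB μ =
      ∑ b, w b - ∑ b, μ b * contestGain w p RA RB μ b - priceB w p RA RB μ * RB := by
  have hD := hμ.2.ne'
  have hS : RA / residualBudget p RB μ * ∑ b, w b * μ b ^ 2 = 2 * (priceA w p RB μ * RA) := by
    rw [priceA]
    field_simp
  have hB : priceB w p RA RB μ * (RB - ∑ b, p b * μ b) = priceA w p RB μ * RA :=
    div_mul_cancel₀ _ hD
  rw [sum_mul_contestGain, contestPayoff]
  simp only [mul_assoc, ← sq, hS, mul_sub, mul_one, Finset.sum_sub_distrib]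
  linarith

theorem le_payoffA_counterContest (hw : ∀ b, 0 < w b) (hτ : ∀ b, τ b ∈ Icc (0 : ℝ) 1)
    (hp : ∀ b, 0 ≤ p b) (hμ : μ ∈ contestProfiles p RB)
    (hmin : IsMinOn (contestPayoff w p RA RB) (contestProfiles p RB) μ)
    (hr : 0 < priceB w p RA RB μ) {FB : Measure (Fin n → ℝ≥0)} (hB : FB ∈ lottoStrategies n RB) :
    contestPayoff w p RA RB μ ≤ payoffA w τ p
      (bidLaw 0 (fun b => w b / priceB w p RA RB μ) (counterContest p RA RB μ)) FB := by
  let e : Fin n → ℝ := fun b => max 0 (contestGain w p RA RB μ b) / w b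
  have he (b : Fin n) : 1 - counterContest p RA RB μ b - priceB w p RA RB μ * p b / w b ≤ e b := by
    refine le_of_eq_of_le ?_ (div_le_div_of_nonneg_right (le_max_right _ _) (hw b).le)
    rw [contestGain, sub_div, mul_div_cancel_left₀ _ (hw b).ne']
  refine le_trans ?_ (le_payoffA_bidLaw hw hτ (budget_pos_of_mem_contestProfiles hp hμ).le hr
    (fun b => div_nonneg (le_max_left _ _) (hw b).le) he hB)
  have hsum : ∑ b, w b * (1 - e b) = ∑ b, w b - ∑ b, max 0 (contestGain w p RA RB μ b) := by
    simp only [e, mul_sub, mul_one, mul_div_cancel₀ _ (hw _).ne', Finset.sum_sub_distrib]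
  rw [hsum, contestPayoff_eq hμ]
  linarith [sum_max_contestGain_le hμ hmin]

theorem counterContest_mem_lottoStrategies (hw : ∀ b, 0 < w b) (hRA : 0 < RA)
    (hμ : μ ∈ contestProfiles p RB) (hS : 0 < ∑ b, w b * μ b ^ 2)
    (hν : counterContest p RA RB μ ∈ Icc 0 1) :
    bidLaw 0 (fun b => w b / priceB w p RA RB μ) (counterContest p RA RB μ) ∈
      lottoStrategies n RA := by
  have hD := hμ.2
  have hr : 0 < priceB w p RA RB μ := by unfold priceB priceA; positivity
  refine bidLaw_div_mem_lottoStrategies hw (fun _ => le_rfl) hν hr hRA.le (le_of_eq ?_)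
  have hsq : ∑ b, w b * counterContest p RA RB μ b ^ 2 =
      (RA / residualBudget p RB μ) ^ 2 * ∑ b, w b * μ b ^ 2 := by
    rw [Finset.mul_sum]
    exact Finset.sum_congr rfl fun b _ => by rw [counterContest]; ring
  rw [hsq, priceB, priceA]
  simp only [zero_mul, Finset.sum_const_zero, zero_add]
  field_simp

theorem isStageTwoNash_of_le_of_le {v : ℝ} {FA FB : Measure (Fin n → ℝ≥0)}
    (hA : FA ∈ lottoStrategies n RA) (hB : FB ∈ lottoStrategies n RB)
    (hle : ∀ GA ∈ lottoStrategies n RA, payoffA w τ p GA FB ≤ v)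
    (hge : ∀ GB ∈ lottoStrategies n RB, v ≤ payoffA w τ p FA GB) :
    IsStageTwoNash w τ p RA RB FA FB ∧ payoffA w τ p FA FB = v where
  left :=
    { memA := hA
      memB := hB
      bestA := fun GA hGA => (hle GA hGA).trans (hge FB hB)
      bestB := fun GB hGB => sub_le_sub_left ((hle FA hA).trans (hge GB hGB)) 1 }
  right := (hle FA hA).antisymm (hge FB hB)

theorem exists_isStageTwoNash_of_isMinOn (hw : ∀ b, 0 < w b) (hw0 : 0 < ∑ b, w b)
    (hτ : ∀ b, τ b ∈ Icc (0 : ℝ) 1) (hp : ∀ b, 0 ≤ p b) (hRA : 0 < RA)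
    (hμ : μ ∈ contestProfiles p RB)
    (hmin : IsMinOn (contestPayoff w p RA RB) (contestProfiles p RB) μ) :
    ∃ FA FB, IsStageTwoNash w τ p RA RB FA FB ∧
      payoffA w τ p FA FB = contestPayoff w p RA RB μ := by
  have hS := sum_mul_sq_pos_of_isMinOn hw hw0 hμ hmin
  have hD := hμ.2
  have hs : 0 < priceA w p RB μ := by unfold priceA; positivity
  have hr : 0 < priceB w p RA RB μ := by unfold priceB; positivity
  refine ⟨bidLaw 0 (fun b => w b / priceB w p RA RB μ) (counterContest p RA RB μ),
    bidLaw p (fun b => w b / priceA w p RB μ) μ, isStageTwoNash_of_le_of_le ?_ ?_ ?_ ?_⟩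
  · exact counterContest_mem_lottoStrategies hw hRA hμ hS
      (counterContest_mem_Icc_of_isMinOn hw hp hRA.le hμ hmin)
  · refine bidLaw_div_mem_lottoStrategies hw hp hμ.1 hs
      (budget_pos_of_mem_contestProfiles hp hμ).le (le_of_eq ?_)
    have hcost : (∑ b, w b * μ b ^ 2) / (2 * priceA w p RB μ) = residualBudget p RB μ := by
      rw [priceA]
      field_simp
    rw [hcost, residualBudget, add_sub_cancel]
  · exact fun GA hGA => payoffA_bidLaw_le hw hτ hRA.le hs hμ.1.2 hGA
  · exact fun GB hGB => le_payoffA_counterContest hw hτ hp hμ hmin hr hGB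

end Saddle

section SubgamePerfect

/-- `v` is player A's payoff in some Nash equilibrium of the second stage after the pre-allocation
`p`. -/
def IsStageTwoPayoff (w τ p : Fin n → ℝ) (RA RB v : ℝ) : Prop :=
  ∃ FA FB, IsStageTwoNash w τ p RA RB FA FB ∧ payoffA w τ p FA FB = v

theorem IsStageTwoPayoff.le {v v' : ℝ} (hv : IsStageTwoPayoff w τ p RA RB v)
    (hv' : IsStageTwoPayoff w τ p RA RB v') : v ≤ v' := by
  obtain ⟨FA, FB, hF, rfl⟩ := hv
  obtain ⟨GA, GB, hG, rfl⟩ := hv'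
  calc payoffA w τ p FA FB ≤ payoffA w τ p FA GB :=
        (sub_le_sub_iff_left 1).1 (hF.bestB GB hG.memB)
    _ ≤ payoffA w τ p GA GB := hG.bestA FA hF.memA

theorem isSPEPayoff_iff {v : ℝ} :
    IsSPEPayoff w τ P RA RB v ↔
      (∀ p ∈ preallocations n P, ∃ v', IsStageTwoPayoff w τ p RA RB v') ∧
        IsGreatest {v' | ∃ p ∈ preallocations n P, IsStageTwoPayoff w τ p RA RB v'} v := by
  constructor
  · rintro ⟨p, FA, FB, hF, rfl⟩
    refine ⟨fun q hq => ⟨_, _, _, hF.nash q hq, rfl⟩, ⟨p, hF.mem, _, _, hF.nash p hF.mem, rfl⟩, ?_⟩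
    rintro v' ⟨q, hq, hv'⟩
    exact (hv'.le ⟨_, _, hF.nash q hq, rfl⟩).trans (hF.optimal q hq)
  · rintro ⟨hex, ⟨p, hp, hpv⟩, hmax⟩
    choose! v' FA FB hF using hex
    have hvp : v = payoffA w τ p (FA p) (FB p) :=
      (hpv.le ⟨_, _, (hF p hp).1, rfl⟩).antisymm (hmax ⟨p, hp, _, _, (hF p hp).1, rfl⟩)
    exact ⟨p, FA, FB,
      { mem := hp
        nash := fun q hq => (hF q hq).1
        optimal := fun q hq => hvp ▸ hmax ⟨q, hq, _, _, (hF q hq).1, rfl⟩ }, hvp⟩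

theorem IsSPEPayoff.unique {v v' : ℝ} (hv : IsSPEPayoff w τ P RA RB v)
    (hv' : IsSPEPayoff w τ P RA RB v') : v = v' :=
  (isSPEPayoff_iff.1 hv).2.unique (isSPEPayoff_iff.1 hv').2

end SubgamePerfect

section UniformContest

/-- The common probabilities with which player B can contest all battlefields, whatever the
distribution of the total pre-allocation `P` is. -/
def uniformContests (P RB : ℝ) : Set ℝ :=
  {m | m ∈ Icc 0 1 ∧ 0 < RB - P * m}

/-- The value of `contestPayoff` at a constant profile. -/
noncomputable def uniformContestPayoff (P RA RB m : ℝ) : ℝ :=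
  1 - m + m ^ 2 / (2 * (RB - P * m)) * RA

/-- The pre-allocation of the budget `P` in proportion to the battlefield values. -/
def proportional (w : Fin n → ℝ) (P : ℝ) (b : Fin n) : ℝ :=
  P * w b

variable {m v : ℝ}

theorem proportional_mem_preallocations (hw : ∀ b, 0 < w b) (hw1 : ∑ b, w b = 1) (hP : 0 ≤ P) :
    proportional w P ∈ preallocations n P :=
  ⟨fun b => mul_nonneg hP (hw b).le, by simp only [proportional, ← Finset.mul_sum, hw1, mul_one]⟩

theorem residualBudget_proportional (μ : Fin n → ℝ) :
    residualBudget (proportional w P) RB μ = RB - P * ∑ b, w b * μ b := by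
  simp only [residualBudget, proportional, mul_assoc, Finset.mul_sum]

theorem residualBudget_const (hp : p ∈ preallocations n P) :
    residualBudget p RB (fun _ => m) = RB - P * m := by
  rw [residualBudget, ← Finset.sum_mul, hp.2]

theorem sum_mul_one_sub (hw1 : ∑ b, w b = 1) (μ : Fin n → ℝ) :
    ∑ b, w b * (1 - μ b) = 1 - ∑ b, w b * μ b := by
  simp only [mul_sub, mul_one, Finset.sum_sub_distrib, hw1]

theorem sum_mul_mem_Icc (hw : ∀ b, 0 < w b) (hw1 : ∑ b, w b = 1) {μ : Fin n → ℝ}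
    (hμ : μ ∈ Icc 0 1) : ∑ b, w b * μ b ∈ Icc (0 : ℝ) 1 :=
  ⟨Finset.sum_nonneg fun b _ => mul_nonneg (hw b).le (hμ.1 b),
    (Finset.sum_le_sum fun b _ => mul_le_of_le_one_right (hw b).le (hμ.2 b)).trans_eq hw1⟩

theorem const_mem_contestProfiles (hp : p ∈ preallocations n P) (hm : m ∈ uniformContests P RB) :
    (fun _ => m) ∈ contestProfiles p RB :=
  ⟨⟨fun _ => hm.1.1, fun _ => hm.1.2⟩, residualBudget_const hp ▸ hm.2⟩

theorem contestPayoff_const (hw1 : ∑ b, w b = 1) (hp : p ∈ preallocations n P) :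
    contestPayoff w p RA RB (fun _ => m) = uniformContestPayoff P RA RB m := by
  simp only [contestPayoff, priceA, residualBudget_const hp, ← Finset.sum_mul, hw1, one_mul,
    uniformContestPayoff]

theorem IsStageTwoPayoff.le_uniformContestPayoff (hw : ∀ b, 0 < w b) (hw1 : ∑ b, w b = 1)
    (hτ : ∀ b, τ b ∈ Icc (0 : ℝ) 1) (hRA : 0 ≤ RA) (hp : p ∈ preallocations n P)
    (hv : IsStageTwoPayoff w τ p RA RB v) (hm : m ∈ uniformContests P RB) :
    v ≤ uniformContestPayoff P RA RB m := by
  obtain ⟨FA, FB, hF, rfl⟩ := hv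
  rw [← contestPayoff_const hw1 hp]
  exact hF.payoffA_le_contestPayoff hw hτ hp.1 hRA (const_mem_contestProfiles hp hm)

theorem IsSPEPayoff.le_uniformContestPayoff (hw : ∀ b, 0 < w b) (hw1 : ∑ b, w b = 1)
    (hτ : ∀ b, τ b ∈ Icc (0 : ℝ) 1) (hRA : 0 ≤ RA) (hv : IsSPEPayoff w τ P RA RB v)
    (hm : m ∈ uniformContests P RB) : v ≤ uniformContestPayoff P RA RB m := by
  obtain ⟨-, ⟨p, hp, hpv⟩, -⟩ := isSPEPayoff_iff.1 hv
  exact hpv.le_uniformContestPayoff hw hw1 hτ hRA hp hm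

theorem uniformContestPayoff_sum_le (hw : ∀ b, 0 < w b) (hw1 : ∑ b, w b = 1) (hRA : 0 ≤ RA)
    {μ : Fin n → ℝ} (hμ : μ ∈ contestProfiles (proportional w P) RB) :
    uniformContestPayoff P RA RB (∑ b, w b * μ b) ≤
      contestPayoff w (proportional w P) RA RB μ := by
  have hD : 0 < RB - P * ∑ b, w b * μ b := residualBudget_proportional μ ▸ hμ.2
  have hJensen : (∑ b, w b * μ b) ^ 2 ≤ ∑ b, w b * μ b ^ 2 :=
    Real.pow_arith_mean_le_arith_mean_pow _ w μ (fun b _ => (hw b).le) hw1 (fun b _ => hμ.1.1 b) 2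
  rw [uniformContestPayoff, contestPayoff, priceA, sum_mul_one_sub hw1, residualBudget_proportional]
  gcongr

theorem exists_isStageTwoPayoff_contestPayoff (hw : ∀ b, 0 < w b) (hw0 : 0 < ∑ b, w b)
    (hτ : ∀ b, τ b ∈ Icc (0 : ℝ) 1) (hp : ∀ b, 0 ≤ p b) (hRA : 0 < RA) (hRB : 0 < RB) :
    ∃ μ ∈ contestProfiles p RB, IsStageTwoPayoff w τ p RA RB (contestPayoff w p RA RB μ) := by
  obtain ⟨μ, hμ, hmin⟩ := exists_isMinOn_contestPayoff (p := p) hw hRA hRB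
  exact ⟨μ, hμ, exists_isStageTwoNash_of_isMinOn hw hw0 hτ hp hRA hμ hmin⟩

theorem exists_isSPEPayoff_and_isLeast (hw : ∀ b, 0 < w b) (hw1 : ∑ b, w b = 1)
    (hτ : ∀ b, τ b ∈ Icc (0 : ℝ) 1) (hP : 0 ≤ P) (hRA : 0 < RA) (hRB : 0 < RB) :
    ∃ v, IsSPEPayoff w τ P RA RB v ∧
      IsLeast (uniformContestPayoff P RA RB '' uniformContests P RB) v := by
  have hw0 : 0 < ∑ b, w b := hw1 ▸ one_pos
  have hprop := proportional_mem_preallocations hw hw1 hP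
  obtain ⟨μ, hμ, hv⟩ := exists_isStageTwoPayoff_contestPayoff hw hw0 hτ hprop.1 hRA hRB
  set v := contestPayoff w (proportional w P) RA RB μ
  have hm : ∑ b, w b * μ b ∈ uniformContests P RB :=
    ⟨sum_mul_mem_Icc hw hw1 hμ.1, residualBudget_proportional μ ▸ hμ.2⟩
  have hle := uniformContestPayoff_sum_le hw hw1 hRA.le hμ
  refine ⟨v, isSPEPayoff_iff.2 ⟨fun p hp => ?_, ⟨_, hprop, hv⟩, ?_⟩,
    ⟨_, hm, hle.antisymm (hv.le_uniformContestPayoff hw hw1 hτ hRA.le hprop hm)⟩, ?_⟩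
  · obtain ⟨_, -, hpv⟩ := exists_isStageTwoPayoff_contestPayoff hw hw0 hτ hp.1 hRA hRB
    exact ⟨_, hpv⟩
  · rintro v' ⟨p, hp, hpv⟩
    exact (hpv.le_uniformContestPayoff hw hw1 hτ hRA.le hp hm).trans hle
  · rintro _ ⟨m, hm, rfl⟩
    exact hv.le_uniformContestPayoff hw hw1 hτ hRA.le hprop hm

theorem isSPEPayoff_iff_isLeast (hw : ∀ b, 0 < w b) (hw1 : ∑ b, w b = 1)
    (hτ : ∀ b, τ b ∈ Icc (0 : ℝ) 1) (hP : 0 ≤ P) (hRA : 0 < RA) (hRB : 0 < RB) :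
    IsSPEPayoff w τ P RA RB v ↔
      IsLeast (uniformContestPayoff P RA RB '' uniformContests P RB) v := by
  obtain ⟨v', hv', hleast⟩ := exists_isSPEPayoff_and_isLeast hw hw1 hτ hP hRA hRB
  exact ⟨fun h => h.unique hv' ▸ hleast, fun h => h.unique hleast ▸ hv'⟩

end UniformContest

section NoRealTimeResources

/-- The probabilities of matching the pre-allocations `p` that player B can afford with budget
`R`. -/
def affordableContests (p : Fin n → ℝ) (R : ℝ) : Set (Fin n → ℝ) :=
  {f | f ∈ Icc 0 1 ∧ 0 ≤ residualBudget p R f}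

theorem mem_lottoStrategies_zero_iff {F : Measure (Fin n → ℝ≥0)} :
    F ∈ lottoStrategies n 0 ↔ F = Measure.dirac 0 := by
  constructor
  · rintro ⟨hF, hcost⟩
    have hcost0 := (lintegral_eq_zero_iff (by fun_prop)).1
      (nonpos_iff_eq_zero.1 (hcost.trans_eq ENNReal.ofReal_zero))
    have hzero : id =ᵐ[F] fun _ => 0 := by
      filter_upwards [hcost0] with x hx
      ext b
      simpa using Finset.sum_eq_zero_iff.1 hx b (Finset.mem_univ b)
    calc F = F.map id := Measure.map_id.symm
      _ = F.map fun _ => 0 := Measure.map_congr hzero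
      _ = Measure.dirac 0 := by rw [Measure.map_const, measure_univ, one_smul]
  · rintro rfl
    exact ⟨inferInstance, by simp⟩

theorem payoffA_zero_dirac {FB : Measure (Fin n → ℝ≥0)} [IsProbabilityMeasure FB] :
    payoffA w 0 p (Measure.dirac 0) FB = ∑ b, w b * (1 - FB.real {y | p b ≤ y b}) := by
  have hmeas (b : Fin n) : MeasurableSet {y : Fin n → ℝ≥0 | p b ≤ y b} :=
    measurableSet_le measurable_const (measurable_toReal_apply b)
  have hwin (b : Fin n) (y : Fin n → ℝ≥0) :
      winProb 0 (p b) (y b) = {y : Fin n → ℝ≥0 | p b ≤ y b}ᶜ.indicator 1 y := by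
    simp [winProb, indicator_apply]
  rw [payoffA_eq_sum]
  simp only [integral_prod _ (integrable_winProb_prod _ _ _), integral_dirac, Pi.zero_apply,
    NNReal.coe_zero, zero_add, hwin, integral_indicator_one (hmeas _).compl,
    probReal_compl_eq_one_sub (hmeas _)]

theorem real_ge_mem_affordableContests (hRB : 0 ≤ RB) {FB : Measure (Fin n → ℝ≥0)}
    (hB : FB ∈ lottoStrategies n RB) :
    (fun b => FB.real {y | p b ≤ y b}) ∈ affordableContests p RB := by
  have := hB.1
  obtain ⟨hi, hcost⟩ := (mem_lottoStrategies_iff hRB).1 hB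
  refine ⟨⟨fun b => measureReal_nonneg, fun b => measureReal_le_one⟩, sub_nonneg.2 ?_⟩
  exact (Finset.sum_le_sum fun b _ => mul_meas_ge_le_integral_of_nonneg
    (.of_forall fun y => (y b).coe_nonneg) (hi b) (p b)).trans hcost

theorem payoffA_zero_dirac_bidLaw_le (hw : ∀ b, 0 < w b) {f : Fin n → ℝ} (hf : ∀ b, f b ≤ 1) :
    payoffA w 0 p (Measure.dirac 0) (bidLaw p 0 f) ≤ ∑ b, w b * (1 - f b) := by
  rw [payoffA_eq_sum]
  gcongr with b
  · exact (hw b).le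
  simp only [integral_prod _ (integrable_winProb_prod _ _ _), integral_dirac, Pi.zero_apply,
    NNReal.coe_zero, zero_add]
  rw [integral_bidLaw (h := winProb 0 (p b)) (measurable_winProb _ measurable_const measurable_id)]
  refine integral_le_one_sub (integrable_winProb _ measurable_const measurable_toReal_bid)
    (fun v => (winProb_mem_Icc (left_mem_Icc.2 zero_le_one) _ _).2) (hf b) fun v hv => ?_
  simp [winProb, bid, hv.le]

theorem exists_isMinOn_affordableContests (hRB : 0 ≤ RB) :
    ∃ f ∈ affordableContests p RB,
      IsMinOn (fun f => ∑ b, w b * (1 - f b)) (affordableContests p RB) f := by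
  have hcompact : IsCompact (affordableContests p RB) :=
    isCompact_Icc.inter_right (isClosed_le continuous_const continuous_residualBudget)
  exact hcompact.exists_isMinOn ⟨0, ⟨le_rfl, zero_le_one⟩, by simpa [residualBudget] using hRB⟩
    (by fun_prop)

theorem isStageTwoPayoff_zero_of_isMinOn (hw : ∀ b, 0 < w b) (hp : ∀ b, 0 ≤ p b) (hRB : 0 ≤ RB)
    {f : Fin n → ℝ} (hf : f ∈ affordableContests p RB)
    (hmin : IsMinOn (fun f => ∑ b, w b * (1 - f b)) (affordableContests p RB) f) :
    IsStageTwoPayoff w 0 p 0 RB (∑ b, w b * (1 - f b)) := by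
  refine ⟨Measure.dirac 0, bidLaw p 0 f, isStageTwoNash_of_le_of_le
    (mem_lottoStrategies_zero_iff.2 rfl) ?_ (fun GA hGA => ?_) fun GB hGB => ?_⟩
  · refine bidLaw_mem_lottoStrategies hp (fun _ => le_rfl) (fun b => ⟨hf.1.1 b, hf.1.2 b⟩) hRB ?_
    simpa using sub_nonneg.1 hf.2
  · rw [mem_lottoStrategies_zero_iff.1 hGA]
    exact payoffA_zero_dirac_bidLaw_le hw hf.1.2
  · have := hGB.1
    rw [payoffA_zero_dirac]
    exact hmin (real_ge_mem_affordableContests hRB hGB)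

theorem exists_isSPEPayoff_zero (hw : ∀ b, 0 < w b) (hw1 : ∑ b, w b = 1) (hP : 0 ≤ P)
    (hRB : 0 ≤ RB) : ∃ v, IsSPEPayoff w 0 P 0 RB v := by
  have hprop := proportional_mem_preallocations hw hw1 hP
  obtain ⟨f, hf, hfmin⟩ := exists_isMinOn_affordableContests (p := proportional w P) (w := w) hRB
  refine ⟨∑ b, w b * (1 - f b), isSPEPayoff_iff.2 ⟨fun p hp => ?_,
    ⟨_, hprop, isStageTwoPayoff_zero_of_isMinOn hw hprop.1 hRB hf hfmin⟩, ?_⟩⟩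
  · obtain ⟨g, hg, hgmin⟩ := exists_isMinOn_affordableContests (p := p) (w := w) hRB
    exact ⟨_, isStageTwoPayoff_zero_of_isMinOn hw hp.1 hRB hg hgmin⟩
  · rintro v ⟨p, hp, hv⟩
    obtain ⟨g, hg, hgmin⟩ := exists_isMinOn_affordableContests (p := p) (w := w) hRB
    have hm := sum_mul_mem_Icc hw hw1 hf.1
    have hconst : (fun _ => ∑ b, w b * f b) ∈ affordableContests p RB :=
      ⟨⟨fun _ => hm.1, fun _ => hm.2⟩, by
        rw [residualBudget_const hp, ← residualBudget_proportional]
        exact hf.2⟩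
    calc v ≤ ∑ b, w b * (1 - g b) := hv.le (isStageTwoPayoff_zero_of_isMinOn hw hp.1 hRB hg hgmin)
      _ ≤ ∑ b, w b * (1 - ∑ c, w c * f c) := hgmin hconst
      _ = ∑ b, w b * (1 - f b) := by rw [← Finset.sum_mul, hw1, one_mul, sum_mul_one_sub hw1]

end NoRealTimeResources

section Investment

/-- Player A's optimal payoff with monetary budget `M` when the unit cost `c` of pre-allocated
resources is at most `min 1 (M / RB)`. -/
noncomputable def optimalPayoff (M c RB : ℝ) : ℝ :=
  1 - RB / (2 * M) * c * (2 - c)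

/-- The largest amount of pre-allocated resources in an optimal investment with monetary budget `M`
when their unit cost `c` is at most `min 1 (M / RB)`. -/
noncomputable def maxPreallocation (M c : ℝ) : ℝ :=
  2 * (1 - c) / (2 - c) * (M / c)

/-- The uniform contest probability with which player B holds player A to at most `optimalPayoff`,
whichever affordable investment with `c * P < M` player A chooses. -/
noncomputable def criticalContest (M c RB : ℝ) : ℝ :=
  c * RB / M

variable {M c : ℝ}

theorem maxPreallocation_nonneg (hM : 0 < M) (hc : 0 < c) (hc1 : c ≤ 1) :
    0 ≤ maxPreallocation M c :=
  mul_nonneg (div_nonneg (by linarith) (by linarith)) (by positivity)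

theorem mul_maxPreallocation_lt (hM : 0 < M) (hc : 0 < c) (hc1 : c ≤ 1) :
    c * maxPreallocation M c < M := by
  have hc2 : 0 < 2 - c := by linarith
  have heq : c * maxPreallocation M c = 2 * (1 - c) / (2 - c) * M := by
    rw [maxPreallocation]
    field_simp
  rw [heq]
  exact mul_lt_of_lt_one_left hM ((div_lt_one hc2).2 (by linarith))

theorem optimalPayoff_eq_sub_criticalContest :
    optimalPayoff M c RB = 1 - criticalContest M c RB + c * criticalContest M c RB / 2 := by
  rw [optimalPayoff, criticalContest]
  ring

theorem sub_mul_criticalContest (hM : 0 < M) :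
    RB - P * criticalContest M c RB = RB * (M - c * P) / M := by
  rw [criticalContest]
  field_simp

theorem criticalContest_mem_Ioc (hM : 0 < M) (hc : 0 < c) (hRB : 0 < RB) (hcM : c * RB ≤ M) :
    criticalContest M c RB ∈ Ioc 0 1 :=
  ⟨by unfold criticalContest; positivity, (div_le_one hM).2 hcM⟩

theorem criticalContest_mem_uniformContests (hM : 0 < M) (hc : 0 < c) (hRB : 0 < RB)
    (hcM : c * RB ≤ M) (hP : c * P < M) : criticalContest M c RB ∈ uniformContests P RB := by
  refine ⟨Ioc_subset_Icc_self (criticalContest_mem_Ioc hM hc hRB hcM), ?_⟩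
  rw [sub_mul_criticalContest hM]
  have := sub_pos.2 hP
  positivity

theorem uniformContestPayoff_criticalContest (hM : 0 < M) (hP : c * P < M) :
    uniformContestPayoff P RA RB (criticalContest M c RB) =
      1 - criticalContest M c RB + c * criticalContest M c RB / 2 * (RA / (M - c * P)) := by
  have := (sub_pos.2 hP).ne'
  rw [uniformContestPayoff, sub_mul_criticalContest hM, criticalContest]
  field_simp

theorem uniformContestPayoff_criticalContest_eq_optimalPayoff (hM : 0 < M) (hP : c * P < M) :
    uniformContestPayoff P (M - c * P) RB (criticalContest M c RB) = optimalPayoff M c RB := by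
  rw [uniformContestPayoff_criticalContest hM hP, div_self (sub_pos.2 hP).ne', mul_one,
    optimalPayoff_eq_sub_criticalContest]

theorem exists_uniformContestPayoff_lt_optimalPayoff (hM : 0 < M) (hc : 0 < c) (hc1 : c ≤ 1)
    (hRB : 0 < RB) (hcM : c * RB ≤ M) (hfeas : (P, RA) ∈ feasibleInvestments M c)
    (hRA : ¬(0 < RA ∧ RA = M - c * P)) :
    ∃ m ∈ uniformContests P RB, uniformContestPayoff P RA RB m < optimalPayoff M c RB := by
  obtain ⟨-, hRA0 : 0 ≤ RA, hbudget : RA + c * P ≤ M⟩ := hfeas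
  have hm := criticalContest_mem_Ioc hM hc hRB hcM
  rw [optimalPayoff_eq_sub_criticalContest]
  rcases lt_or_ge (c * P) M with hP | hP
  · refine ⟨_, criticalContest_mem_uniformContests hM hc hRB hcM hP, ?_⟩
    have hRAlt : RA < M - c * P := by
      refine (le_sub_iff_add_le.2 hbudget).lt_of_ne fun h => hRA ⟨?_, h⟩
      exact h ▸ sub_pos.2 hP
    rw [uniformContestPayoff_criticalContest hM hP, add_lt_add_iff_left]
    exact mul_lt_of_lt_one_right (by have := hm.1; positivity)
      ((div_lt_one (sub_pos.2 hP)).2 hRAlt)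
  · obtain rfl : RA = 0 := by linarith
    have hcP : P * criticalContest M c RB = RB := by
      linarith [sub_mul_criticalContest (P := P) (c := c) (RB := RB) hM,
        show RB * (M - c * P) / M = 0 by rw [show c * P = M by linarith]; simp]
    -- Without real-time resources the payoff is `1 - m`, so any affordable `m` slightly below the
    -- critical contest will do.
    refine ⟨criticalContest M c RB * (1 - c / 4), ⟨⟨?_, ?_⟩, ?_⟩, ?_⟩
    · exact mul_nonneg hm.1.le (by linarith)
    · exact mul_le_one₀ hm.2 (by linarith) (by linarith)
    · rw [← mul_assoc, hcP]
      nlinarith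
    · rw [uniformContestPayoff, mul_zero]
      nlinarith [hm.1]

theorem uniformContestPayoff_sub_optimalPayoff (hM : 0 < M) (hc : 0 < c) (hc1 : c ≤ 1)
    {m : ℝ} (hm : m ∈ uniformContests P RB) :
    (uniformContestPayoff P (M - c * P) RB m - optimalPayoff M c RB) * (2 * (RB - P * m)) =
      (m - criticalContest M c RB) * ((2 * P + (M - c * P)) * (m - criticalContest M c RB) +
        criticalContest M c RB * (2 - c) * (P - maxPreallocation M c)) := by
  have hc2 : 2 - c ≠ 0 := by linarith
  have hprice : m ^ 2 / (2 * (RB - P * m)) * (2 * (RB - P * m)) = m ^ 2 :=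
    div_mul_cancel₀ _ (mul_pos two_pos hm.2).ne'
  calc
    _ = (1 - m - optimalPayoff M c RB) * (2 * (RB - P * m)) +
        m ^ 2 / (2 * (RB - P * m)) * (2 * (RB - P * m)) * (M - c * P) := by
      rw [uniformContestPayoff]
      ring
    _ = _ := by
      rw [hprice, optimalPayoff, criticalContest, maxPreallocation]
      field_simp
      ring

theorem optimalPayoff_mem_lowerBounds_iff_forall_nonneg (hM : 0 < M) (hc : 0 < c) (hc1 : c ≤ 1) :
    optimalPayoff M c RB ∈
        lowerBounds (uniformContestPayoff P (M - c * P) RB '' uniformContests P RB) ↔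
      ∀ m ∈ uniformContests P RB, 0 ≤ (m - criticalContest M c RB) *
        ((2 * P + (M - c * P)) * (m - criticalContest M c RB) +
          criticalContest M c RB * (2 - c) * (P - maxPreallocation M c)) := by
  rw [mem_lowerBounds, forall_mem_image]
  refine forall₂_congr fun m hm => ?_
  rw [← uniformContestPayoff_sub_optimalPayoff hM hc hc1 hm,
    mul_nonneg_iff_of_pos_right (mul_pos two_pos hm.2), sub_nonneg]

theorem le_maxPreallocation_of_mem_lowerBounds (hM : 0 < M) (hc : 0 < c) (hc1 : c ≤ 1)
    (hRB : 0 < RB) (hcM : c * RB ≤ M) (hP : 0 ≤ P) (hcP : c * P < M)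
    (h : optimalPayoff M c RB ∈
      lowerBounds (uniformContestPayoff P (M - c * P) RB '' uniformContests P RB)) :
    P ≤ maxPreallocation M c := by
  rw [optimalPayoff_mem_lowerBounds_iff_forall_nonneg hM hc hc1] at h
  obtain ⟨hcrit0, hcrit1⟩ := criticalContest_mem_Ioc hM hc hRB hcM
  have hD := (criticalContest_mem_uniformContests hM hc hRB hcM hcP).2
  have hnonneg : 0 ≤ criticalContest M c RB * (2 - c) * (maxPreallocation M c - P) := by
    refine nonneg_of_eventually_nonneg_mul (a := 2 * P + (M - c * P)) ?_
    filter_upwards [Ioc_mem_nhdsGT hcrit0] with x hx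
    refine (h (criticalContest M c RB - x) ⟨⟨by linarith [hx.2], by linarith [hx.1]⟩, ?_⟩
      ).trans_eq (by ring)
    nlinarith [hx.1]
  exact sub_nonneg.1 ((mul_nonneg_iff_of_pos_left (mul_pos hcrit0 (by linarith))).1 hnonneg)

theorem maxPreallocation_le_of_mem_lowerBounds (hM : 0 < M) (hc : 0 < c) (hc1 : c ≤ 1)
    (hRB : 0 < RB) (hcM : c * RB < M) (hcP : c * P < M)
    (h : optimalPayoff M c RB ∈
      lowerBounds (uniformContestPayoff P (M - c * P) RB '' uniformContests P RB)) :
    maxPreallocation M c ≤ P := by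
  rw [optimalPayoff_mem_lowerBounds_iff_forall_nonneg hM hc hc1] at h
  have hcrit0 := (criticalContest_mem_Ioc hM hc hRB hcM.le).1
  have hcrit1 : criticalContest M c RB < 1 := (div_lt_one hM).2 hcM
  have hD : ∀ᶠ x in 𝓝[>] 0, 0 < RB - P * (criticalContest M c RB + x) := by
    refine Tendsto.eventually_const_lt
      (criticalContest_mem_uniformContests hM hc hRB hcM.le hcP).2 ?_
    exact (Continuous.tendsto' (by fun_prop) _ _ (by simp)).mono_left nhdsWithin_le_nhds
  have hnonneg : 0 ≤ criticalContest M c RB * (2 - c) * (P - maxPreallocation M c) := by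
    refine nonneg_of_eventually_nonneg_mul (a := 2 * P + (M - c * P)) ?_
    filter_upwards [hD, Ioc_mem_nhdsGT (sub_pos.2 hcrit1)] with x hxD hx
    exact (h (criticalContest M c RB + x)
      ⟨⟨by linarith [hx.1], by linarith [hx.2]⟩, hxD⟩).trans_eq (by ring)
  exact sub_nonneg.1 ((mul_nonneg_iff_of_pos_left (mul_pos hcrit0 (by linarith))).1 hnonneg)

theorem optimalPayoff_mem_lowerBounds_iff (hM : 0 < M) (hc : 0 < c) (hc1 : c ≤ 1) (hRB : 0 < RB)
    (hcM : c * RB ≤ M) (hP : 0 ≤ P) (hcP : c * P < M) :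
    optimalPayoff M c RB ∈
        lowerBounds (uniformContestPayoff P (M - c * P) RB '' uniformContests P RB) ↔
      P ≤ maxPreallocation M c ∧ (c * RB < M → P = maxPreallocation M c) := by
  constructor
  · intro h
    have hle := le_maxPreallocation_of_mem_lowerBounds hM hc hc1 hRB hcM hP hcP h
    exact ⟨hle, fun hlt => hle.antisymm
      (maxPreallocation_le_of_mem_lowerBounds hM hc hc1 hRB hlt hcP h)⟩
  · rintro ⟨hle, heq⟩
    rw [optimalPayoff_mem_lowerBounds_iff_forall_nonneg hM hc hc1]
    intro m hm
    have hA : 0 ≤ 2 * P + (M - c * P) := by linarith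
    have hk : 0 ≤ criticalContest M c RB * (2 - c) :=
      mul_nonneg (criticalContest_mem_Ioc hM hc hRB hcM).1.le (by linarith)
    rcases le_or_gt m (criticalContest M c RB) with hmle | hmgt
    · exact mul_nonneg_of_nonpos_of_nonpos (sub_nonpos.2 hmle)
        (add_nonpos (mul_nonpos_of_nonneg_of_nonpos hA (sub_nonpos.2 hmle))
          (mul_nonpos_of_nonneg_of_nonpos hk (sub_nonpos.2 hle)))
    · obtain rfl := heq ((div_lt_one hM).1 (hmgt.trans_le hm.1.2))
      rw [sub_self, mul_zero, add_zero]
      have := sub_pos.2 hmgt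
      positivity

end Investment

section OptimalInvestment

variable {M c v : ℝ}

theorem maxPreallocation_one : maxPreallocation M 1 = 0 := by
  simp [maxPreallocation]

theorem optimalPayoff_one : optimalPayoff M 1 RB = 1 - RB / (2 * M) := by
  rw [optimalPayoff]
  ring

theorem optimalPayoff_div (hM : 0 < M) (hRB : 0 < RB) :
    optimalPayoff M (M / RB) RB = M / (2 * RB) := by
  rw [optimalPayoff]
  field_simp
  ring

theorem IsSPEPayoff.le_optimalPayoff (hw : ∀ b, 0 < w b) (hw1 : ∑ b, w b = 1)
    (hτ : ∀ b, τ b ∈ Icc (0 : ℝ) 1) (hM : 0 < M) (hc : 0 < c) (hc1 : c ≤ 1) (hRB : 0 < RB)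
    (hcM : c * RB ≤ M) (hfeas : (P, RA) ∈ feasibleInvestments M c)
    (hv : IsSPEPayoff w τ P RA RB v) : v ≤ optimalPayoff M c RB := by
  by_cases hRA : 0 < RA ∧ RA = M - c * P
  · obtain ⟨hpos, rfl⟩ := hRA
    have hcP := sub_pos.1 hpos
    exact (hv.le_uniformContestPayoff hw hw1 hτ hpos.le
      (criticalContest_mem_uniformContests hM hc hRB hcM hcP)).trans_eq
      (uniformContestPayoff_criticalContest_eq_optimalPayoff hM hcP)
  · obtain ⟨m, hm, hlt⟩ :=
      exists_uniformContestPayoff_lt_optimalPayoff hM hc hc1 hRB hcM hfeas hRA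
    exact (hv.le_uniformContestPayoff hw hw1 hτ hfeas.2.1 hm).trans hlt.le

theorem isSPEPayoff_optimalPayoff_iff (hw : ∀ b, 0 < w b) (hw1 : ∑ b, w b = 1)
    (hτ : ∀ b, τ b ∈ Icc (0 : ℝ) 1) (hM : 0 < M) (hc : 0 < c) (hc1 : c ≤ 1) (hRB : 0 < RB)
    (hcM : c * RB ≤ M) (hP : 0 ≤ P) (hcP : c * P < M) :
    IsSPEPayoff w τ P (M - c * P) RB (optimalPayoff M c RB) ↔
      P ≤ maxPreallocation M c ∧ (c * RB < M → P = maxPreallocation M c) := by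
  rw [isSPEPayoff_iff_isLeast hw hw1 hτ hP (sub_pos.2 hcP) hRB, IsLeast,
    optimalPayoff_mem_lowerBounds_iff hM hc hc1 hRB hcM hP hcP]
  exact and_iff_right ⟨_, criticalContest_mem_uniformContests hM hc hRB hcM hcP,
    uniformContestPayoff_criticalContest_eq_optimalPayoff hM hcP⟩

theorem isOptimalInvestment_optimalPayoff_iff (hw : ∀ b, 0 < w b) (hw1 : ∑ b, w b = 1)
    (hτ : ∀ b, τ b ∈ Icc (0 : ℝ) 1) (hM : 0 < M) (hc : 0 < c) (hc1 : c ≤ 1) (hRB : 0 < RB)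
    (hcM : c * RB ≤ M) :
    IsOptimalInvestment w τ M c RB P RA (optimalPayoff M c RB) ↔
      (P ∈ Icc 0 (maxPreallocation M c) ∧ (c * RB < M → P = maxPreallocation M c)) ∧
        RA = M - c * P := by
  constructor
  · rintro ⟨hfeas, hv, -⟩
    by_cases hRA : 0 < RA ∧ RA = M - c * P
    · obtain ⟨hpos, rfl⟩ := hRA
      obtain ⟨hle, heq⟩ := (isSPEPayoff_optimalPayoff_iff hw hw1 hτ hM hc hc1 hRB hcM hfeas.1
        (sub_pos.1 hpos)).1 hv
      exact ⟨⟨⟨hfeas.1, hle⟩, heq⟩, rfl⟩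
    · obtain ⟨m, hm, hlt⟩ :=
        exists_uniformContestPayoff_lt_optimalPayoff hM hc hc1 hRB hcM hfeas hRA
      exact absurd (hv.le_uniformContestPayoff hw hw1 hτ hfeas.2.1 hm) hlt.not_ge
  · rintro ⟨⟨⟨hP, hle⟩, heq⟩, rfl⟩
    have hcP : c * P < M :=
      (mul_le_mul_of_nonneg_left hle hc.le).trans_lt (mul_maxPreallocation_lt hM hc hc1)
    exact ⟨⟨hP, (sub_pos.2 hcP).le, (sub_add_cancel M (c * P)).le⟩,
      (isSPEPayoff_optimalPayoff_iff hw hw1 hτ hM hc hc1 hRB hcM hP hcP).2 ⟨hle, heq⟩,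
      fun y hy u hu => hu.le_optimalPayoff hw hw1 hτ hM hc hc1 hRB hcM hy⟩

theorem IsOptimalInvestment.payoff_unique {P' RA' v' : ℝ}
    (h : IsOptimalInvestment w τ M c RB P RA v) (h' : IsOptimalInvestment w τ M c RB P' RA' v') :
    v = v' :=
  (h'.2.2 _ h.1 _ h.2.1).antisymm (h.2.2 _ h'.1 _ h'.2.1)

theorem isOptimalInvestment_iff_of_le (hw : ∀ b, 0 < w b) (hw1 : ∑ b, w b = 1)
    (hτ : ∀ b, τ b ∈ Icc (0 : ℝ) 1) (hM : 0 < M) (hc : 0 < c) (hRB : 0 < RB)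
    (hct : c ≤ min 1 (M / RB)) :
    IsOptimalInvestment w τ M c RB P RA v ↔
      ((P ∈ Icc 0 (maxPreallocation M c) ∧ (c < min 1 (M / RB) → P = maxPreallocation M c)) ∧
        RA = M - c * P) ∧ v = optimalPayoff M c RB := by
  obtain ⟨hc1, hcM⟩ := le_min_iff.1 hct
  rw [le_div_iff₀ hRB] at hcM
  have hopt {P RA : ℝ} := isOptimalInvestment_optimalPayoff_iff (P := P) (RA := RA)
    hw hw1 hτ hM hc hc1 hRB hcM
  have hv (h : IsOptimalInvestment w τ M c RB P RA v) : v = optimalPayoff M c RB :=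
    h.payoff_unique (hopt.2
      ⟨⟨right_mem_Icc.2 (maxPreallocation_nonneg hM hc hc1), fun _ => rfl⟩, rfl⟩)
  have hcond : (P ∈ Icc 0 (maxPreallocation M c) ∧ (c * RB < M → P = maxPreallocation M c)) ↔
      P ∈ Icc 0 (maxPreallocation M c) ∧ (c < min 1 (M / RB) → P = maxPreallocation M c) := by
    rw [lt_min_iff, lt_div_iff₀ hRB]
    rcases hc1.lt_or_eq with hlt | rfl
    · simp only [hlt, true_and]
    · simp only [maxPreallocation_one, Icc_self, mem_singleton_iff]
      tauto
  rw [← hcond, ← hopt]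
  exact ⟨fun h => ⟨hv h ▸ h, hv h⟩, fun h => h.2 ▸ h.1⟩

theorem feasibleInvestments_subset {c' : ℝ} (hcc : c' ≤ c) :
    feasibleInvestments M c ⊆ feasibleInvestments M c' :=
  fun _ ⟨hP, hRA, hbudget⟩ =>
    ⟨hP, hRA, (add_le_add_right (mul_le_mul_of_nonneg_right hcc hP) _).trans hbudget⟩

theorem isOptimalInvestment_iff_of_price_le {c' v' : ℝ} (hcc : c' ≤ c)
    (h0 : IsOptimalInvestment w τ M c' RB 0 M v') :
    IsOptimalInvestment w τ M c RB P RA v ↔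
      (P, RA) ∈ feasibleInvestments M c ∧ IsOptimalInvestment w τ M c' RB P RA v := by
  have hsub := feasibleInvestments_subset (M := M) hcc
  refine ⟨fun h => ⟨h.1, hsub h.1, h.2.1, fun y hy u hu => ?_⟩,
    fun h => ⟨h.1, h.2.2.1, fun y hy => h.2.2.2 y (hsub hy)⟩⟩
  have hv' : v' ≤ v := h.2.2 (0, M) ⟨le_rfl, h0.1.2.1, by simp⟩ v' h0.2.1
  exact (h0.2.2 y hy u hu).trans hv'

theorem isOptimalInvestment_iff_of_lt (hw : ∀ b, 0 < w b) (hw1 : ∑ b, w b = 1)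
    (hτ : ∀ b, τ b ∈ Icc (0 : ℝ) 1) (hM : 0 < M) (hRB : 0 < RB) (htc : min 1 (M / RB) < c) :
    IsOptimalInvestment w τ M c RB P RA v ↔
      (P = 0 ∧ RA = M - c * P) ∧ v = optimalPayoff M (min 1 (M / RB)) RB := by
  set t := min 1 (M / RB) with ht
  have ht0 : 0 < t := lt_min one_pos (by positivity)
  have hopt {P RA v : ℝ} := isOptimalInvestment_iff_of_le (P := P) (RA := RA) (v := v)
    hw hw1 hτ hM ht0 hRB le_rfl
  simp only [← ht, lt_irrefl, false_imp_iff, and_true] at hopt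
  have hQ : 0 ≤ maxPreallocation M t := maxPreallocation_nonneg hM ht0 (min_le_left _ _)
  rw [isOptimalInvestment_iff_of_price_le htc.le
    (hopt.2 ⟨⟨left_mem_Icc.2 hQ, by simp⟩, rfl⟩), hopt]
  constructor
  · rintro ⟨⟨hP, -, hbudget⟩, ⟨-, rfl⟩, rfl⟩
    have hP0 : P = 0 := hP.antisymm' (by nlinarith)
    exact ⟨⟨hP0, by simp [hP0]⟩, rfl⟩
  · rintro ⟨⟨rfl, rfl⟩, rfl⟩
    exact ⟨⟨le_rfl, by simpa using hM.le, by simp⟩, ⟨left_mem_Icc.2 hQ, by simp⟩, rfl⟩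

theorem isOptimalInvestment_iff (hw : ∀ b, 0 < w b) (hw1 : ∑ b, w b = 1)
    (hτ : ∀ b, τ b ∈ Icc (0 : ℝ) 1) (hM : 0 < M) (hc : 0 < c) (hRB : 0 < RB)
    {t : ℝ} (ht : t = min 1 (M / RB)) :
    IsOptimalInvestment w τ M c RB P RA v ↔
      (((c < t → P = maxPreallocation M c) ∧ (c = t → P ∈ Icc 0 (maxPreallocation M c)) ∧
        (t < c → P = 0)) ∧ RA = M - c * P) ∧ v = optimalPayoff M (min c t) RB := by
  subst ht
  rcases le_or_gt c (min 1 (M / RB)) with hle | hlt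
  · have hQ := maxPreallocation_nonneg hM hc (le_min_iff.1 hle).1
    rw [isOptimalInvestment_iff_of_le hw hw1 hτ hM hc hRB hle, min_eq_left hle]
    rcases hle.lt_or_eq with hlt | heq
    · have : P ∈ Icc 0 (maxPreallocation M c) ∧ P = maxPreallocation M c ↔
          P = maxPreallocation M c := and_iff_right_of_imp fun h => h.symm ▸ right_mem_Icc.2 hQ
      simp only [hlt, hlt.ne, hlt.not_gt, this, true_imp_iff, false_imp_iff, and_true]
    · simp only [← heq, lt_irrefl, true_imp_iff, false_imp_iff, and_true, true_and]
  · rw [isOptimalInvestment_iff_of_lt hw hw1 hτ hM hRB hlt, min_eq_right hlt.le]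
    simp only [hlt, hlt.ne', hlt.not_gt, true_imp_iff, false_imp_iff, true_and]

theorem exists_isSPEPayoff (hw : ∀ b, 0 < w b) (hw1 : ∑ b, w b = 1)
    (hτ : ∀ b, τ b ∈ Icc (0 : ℝ) 1) (hP : 0 ≤ P) (hRA : 0 ≤ RA) (hRB : 0 < RB)
    (h : 0 < RA ∨ ∀ b, τ b = 0) : ∃ v, IsSPEPayoff w τ P RA RB v := by
  rcases hRA.lt_or_eq with hpos | rfl
  · exact (exists_isSPEPayoff_and_isLeast hw hw1 hτ hP hpos hRB).imp fun _ hv => hv.1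
  · obtain rfl : τ = 0 := funext (h.resolve_left (lt_irrefl 0))
    exact exists_isSPEPayoff_zero hw hw1 hP hRB.le

end OptimalInvestment

end GeneralLotto

theorem mainTheorem3 (n : ℕ) (w τ : Fin n → ℝ)
    (hw : ∀ b, 0 < w b) (hw1 : ∑ b, w b = 1) (hτ : ∀ b, τ b ∈ Set.Icc (0 : ℝ) 1)
    (MA cA RB : ℝ) (hMA : 0 < MA) (hcA : 0 < cA) (hRB : 0 < RB)
    (t : ℝ) (ht : t = min 1 (MA / RB)) :
    -- the equilibrium payoff is well defined
    (∀ P RA : ℝ, 0 ≤ P → 0 ≤ RA →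
      (∀ v v' : ℝ, GeneralLotto.IsSPEPayoff w τ P RA RB v →
        GeneralLotto.IsSPEPayoff w τ P RA RB v' → v = v') ∧
      ((0 < RA ∨ ∀ b, τ b = 0) → ∃ v : ℝ, GeneralLotto.IsSPEPayoff w τ P RA RB v)) ∧
    -- the optimal investments
    (∀ P RA : ℝ, (∃ v : ℝ, GeneralLotto.IsOptimalInvestment w τ MA cA RB P RA v) ↔
      ((cA < t → P = 2 * (1 - cA) / (2 - cA) * (MA / cA)) ∧
       (cA = t → P ∈ Set.Icc 0 (2 * (1 - cA) / (2 - cA) * (MA / cA))) ∧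
       (t < cA → P = 0)) ∧
      RA = MA - cA * P) ∧
    -- the optimal payoff
    (∀ P RA v : ℝ, GeneralLotto.IsOptimalInvestment w τ MA cA RB P RA v →
      (cA < t → v = 1 - RB / (2 * MA) * cA * (2 - cA)) ∧
      (t ≤ cA → 1 ≤ MA / RB → v = 1 - RB / (2 * MA)) ∧
      (t ≤ cA → MA / RB < 1 → v = MA / (2 * RB))) := by
  have hopt {P RA v : ℝ} := GeneralLotto.isOptimalInvestment_iff (P := P) (RA := RA) (v := v)
    hw hw1 hτ hMA hcA hRB ht
  refine ⟨fun P RA hP hRA => ⟨fun v v' hv hv' => hv.unique hv',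
    GeneralLotto.exists_isSPEPayoff hw hw1 hτ hP hRA hRB⟩, fun P RA => ?_, fun P RA v hv => ?_⟩
  · simp only [hopt, exists_and_left, exists_eq, and_true, GeneralLotto.maxPreallocation]
  · obtain ⟨-, rfl⟩ := hopt.1 hv
    refine ⟨fun hlt => ?_, fun hle hge => ?_, fun hle hlt => ?_⟩
    · rw [min_eq_left hlt.le, GeneralLotto.optimalPayoff]
    · rw [min_eq_right hle, ht, min_eq_left hge, GeneralLotto.optimalPayoff_one]
    · rw [min_eq_right hle, ht, min_eq_right hlt.le, GeneralLotto.optimalPayoff_div hMA hRB]
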